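/- Let $A$ be a unital $\mathrm{C}^*$-algebra and let $D\subset A$ be a sub-$\mathrm{C}^*$-algebra containing $1_A$. Write $\mathcal N_A(D)=\{v\in A: vDv^*\cup v^*Dv\subset D\}$ for the set of normalisers. Call $(D\subset A)$ a \emph{diagonal pair} if $D$ is a maximal abelian $^*$-subalgebra (masa) of $A$, $\mathcal N_A(D)$ generates $A$ as a $\mathrm{C}^*$-algebra, there is a faithful conditional expectation $\Phi\colon A\to D$ (it is then unique, and is called the associated conditional expectation), and every pure state on $D$ extends uniquely to a pure state on $A$. For $d\in\mathbb N=\{0,1,2,\dots\}$ write $\dim_{\mathrm{diag}}(D\subset A)\le d$ if for every finite set $S\subset A$ and every $\varepsilon>0$ there are a finite-dimensional $\mathrm{C}^*$-algebra $F=\bigoplus_{j=0}^dF^{(j)}$ with a masa $D_F=\bigoplus_{j=0}^dD_{F^{(j)}}$ and completely positive maps $\psi\colon A\to F$ and $\varphi\colon F\to A$ such that $\psi$ is contractive, $\|\varphi\psi(a)-a\|<\varepsilon$ for all $a\in S$, $\psi(D)\subset D_F$, and, for each $j=0,\dots,d$, the restriction $\varphi^{(j)}=\varphi|_{F^{(j)}}$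 is contractive and of order zero (i.e. $\varphi^{(j)}(x)\varphi^{(j)}(y)=0$ whenever $x,y\in F^{(j)}_+$ and $xy=0$) and satisfies $\varphi^{(j)}(\mathcal N_{F^{(j)}}(D_{F^{(j)}}))\subset\mathcal N_A(D)$. The diagonal dimension $\dim_{\mathrm{diag}}(D\subset A)\in\mathbb N\cup\{\infty\}$ is the least such $d$, and $\infty$ if there is none. \textbf{Proposition.} Let $(D\subset A)$ be a unital diagonal pair with associated conditional expectation $\Phi\colon A\to D$. If $\dim_{\mathrm{diag}}(D\subset A)<\infty$, then $\Phi$ is hereditary: for every $a\in A_+$, the element $a$ lies in $\mathrm{her}(\Phi(a))$, the hereditary sub-$\mathrm{C}^*$-algebra of $A$ generated by $\Phi(a)$. -/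

import Mathlib

namespace DiagonalPair

open scoped ComplexOrder CStarAlgebra

/-- `D` is a maximal abelian ⋆-subalgebra (masa) of the unital ⋆-algebra `A`. Every ⋆-subalgebra
containing `D` contains `1`, so it is enough to compare with unital ⋆-subalgebras. -/
def IsMasa {A : Type*} [Ring A] [StarRing A] [Algebra ℂ A] [StarModule ℂ A]
    (D : StarSubalgebra ℂ A) : Prop :=
  Maximal (fun S : StarSubalgebra ℂ A => ∀ x ∈ S, ∀ y ∈ S, x * y = y * x) D

/-- The set of normalisers `{v ∈ A : v D v⋆ ∪ v⋆ D v ⊆ D}`. -/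
def normalisers {A : Type*} [Ring A] [StarRing A] [Algebra ℂ A] [StarModule ℂ A]
    (D : StarSubalgebra ℂ A) : Set A :=
  {v | ∀ x ∈ D, v * x * star v ∈ D ∧ star v * x * v ∈ D}

/-- The states on a unital C⋆-algebra: the positive linear functionals `ω` with `ω 1 = 1`. -/
def states (B : Type*) [Ring B] [StarRing B] [Algebra ℂ B] : Set (B →ₗ[ℂ] ℂ) :=
  {ω | (∀ b : B, 0 ≤ ω (star b * b)) ∧ ω 1 = 1}

/-- The pure states: the extreme points of the convex set of states. -/
def pureStates (B : Type*) [Ring B] [StarRing B] [Algebra ℂ B] : Set (B →ₗ[ℂ] ℂ) :=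
  Set.extremePoints ℝ (states B)

/-- Every pure state on `D` extends uniquely to a pure state on `A`. -/
def UniqueExtensionProperty {A : Type*} [Ring A] [StarRing A] [Algebra ℂ A] [StarModule ℂ A]
    (D : StarSubalgebra ℂ A) : Prop :=
  ∀ θ ∈ pureStates D, ∃! ω : A →ₗ[ℂ] ℂ, ω ∈ pureStates A ∧ ∀ x : D, ω x = θ x

section CStar

variable {A : Type*} [CStarAlgebra A] [PartialOrder A] [StarOrderedRing A]

/-- `Φ : A → D` is a conditional expectation: a positive `D`-bimodule map that restricts to the
identity on `D`. -/
structure IsConditionalExpectation (D : StarSubalgebra ℂ A) (Φ : A →ₗ[ℂ] D) : Prop where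
  nonneg : ∀ a : A, 0 ≤ a → 0 ≤ (Φ a : A)
  apply_coe : ∀ x : D, Φ (x : A) = x
  bimodule : ∀ (x y : D) (a : A), Φ ((x : A) * a * (y : A)) = x * Φ a * y

/-- A positive map `Φ : A → D` is faithful if `a ≥ 0` and `Φ a = 0` imply `a = 0`. -/
def IsFaithful (D : StarSubalgebra ℂ A) (Φ : A →ₗ[ℂ] D) : Prop :=
  ∀ a : A, 0 ≤ a → Φ a = 0 → a = 0

/-- `(D ⊂ A)` is a unital Cartan pair. Non-degeneracy (`D` contains an approximate unit of `A`)
holds because a `StarSubalgebra` contains `1`. -/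
structure IsCartanPair (D : StarSubalgebra ℂ A) : Prop where
  isClosed : IsClosed (D : Set A)
  masa : IsMasa D
  regular : (StarAlgebra.adjoin ℂ (normalisers D)).topologicalClosure = ⊤
  exists_expectation : ∃ Φ : A →ₗ[ℂ] D, IsConditionalExpectation D Φ ∧ IsFaithful D Φ

/-- `(D ⊂ A)` is a unital diagonal pair. -/
structure IsDiagonalPair (D : StarSubalgebra ℂ A) : Prop extends IsCartanPair D where
  uniqueExtension : UniqueExtensionProperty D

/-- `Φ` is the conditional expectation associated with a Cartan pair `(D ⊂ A)`, that is, the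
(unique) faithful conditional expectation onto `D`. -/
structure IsAssociatedExpectation (D : StarSubalgebra ℂ A) (Φ : A →ₗ[ℂ] D) : Prop extends
    IsConditionalExpectation D Φ where
  faithful : IsFaithful D Φ

/-- `H` is a hereditary sub-C⋆-algebra of `A`. -/
structure IsHereditarySubalgebra (H : NonUnitalStarSubalgebra ℂ A) : Prop where
  isClosed : IsClosed (H : Set A)
  hereditary : ∀ x y : A, y ∈ H → 0 ≤ x → x ≤ y → x ∈ H

/-- `her a`: the hereditary sub-C⋆-algebra of `A` generated by `a`. -/
noncomputable def her (a : A) : NonUnitalStarSubalgebra ℂ A :=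
  sInf {H | IsHereditarySubalgebra H ∧ a ∈ H}

/-- A positive map `Φ : A → D` is hereditary if `a ∈ her (Φ a)` for every positive `a`. -/
def IsHereditaryMap (D : StarSubalgebra ℂ A) (Φ : A →ₗ[ℂ] D) : Prop :=
  ∀ a : A, 0 ≤ a → a ∈ her (Φ a : A)

/-- A positive linear map has order zero if it maps orthogonal positive elements to orthogonal
elements. -/
def IsOrderZero {B : Type*} [CStarAlgebra B] [PartialOrder B] [StarOrderedRing B]
    (φ : B →ₗ[ℂ] A) : Prop :=
  ∀ x y : B, 0 ≤ x → 0 ≤ y → x * y = 0 → φ x * φ y = 0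

end CStar

/-- A finite-dimensional C⋆-algebra with its canonical order, together with a masa. -/
structure FinDimPair where
  carrier : Type
  [cstar : CStarAlgebra carrier]
  [order : PartialOrder carrier]
  [starOrdered : StarOrderedRing carrier]
  [finDim : FiniteDimensional ℂ carrier]
  masa : StarSubalgebra ℂ carrier
  isMasa : IsMasa masa

attribute [instance] FinDimPair.cstar FinDimPair.order FinDimPair.starOrdered FinDimPair.finDim

section DiagDim

variable {A : Type*} [CStarAlgebra A] [PartialOrder A] [StarOrderedRing A]

/-- The diagonal dimension of `(D ⊂ A)` is at most `d`: for every finite `S ⊂ A` and `ε > 0` there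
are finite-dimensional C⋆-algebras with masas `(D_{F i} ⊂ F i)`, `i = 0, …, d`, and c.p. maps
`ψ : A → ⨁ i, F i` and `φ : ⨁ i, F i → A`, with `ψ` contractive and mapping `D` into
`⨁ i, D_{F i}`, such that `φ ∘ ψ` is within `ε` of the identity on `S` and each restriction
`φ|_{F i}` is contractive, of order zero, and maps normalisers of `D_{F i}` to normalisers
of `D`. -/
def DiagDimLE (D : StarSubalgebra ℂ A) (d : ℕ) : Prop :=
  ∀ (S : Finset A) (ε : ℝ), 0 < ε →
    ∃ (F : Fin (d + 1) → FinDimPair)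
      (ψ : A →CP ((i : Fin (d + 1)) → (F i).carrier))
      (φ : ((i : Fin (d + 1)) → (F i).carrier) →CP A),
      (∀ a : A, ‖ψ a‖ ≤ ‖a‖) ∧
      (∀ a ∈ S, ‖φ (ψ a) - a‖ < ε) ∧
      (∀ x ∈ D, ∀ i, ψ x i ∈ (F i).masa) ∧
      (∀ (i : Fin (d + 1)) (x : (F i).carrier), ‖φ (Pi.single i x)‖ ≤ ‖x‖) ∧
      (∀ i : Fin (d + 1), IsOrderZero
        (φ.toLinearMap ∘ₗ LinearMap.single ℂ (fun j => (F j).carrier) i)) ∧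
      (∀ (i : Fin (d + 1)), ∀ v ∈ normalisers (F i).masa,
        φ (Pi.single i v) ∈ normalisers D)

/-- The diagonal dimension of `(D ⊂ A)`: the least `d` with `DiagDimLE D d`, and `⊤` if there is
none. -/
noncomputable def diagDim (D : StarSubalgebra ℂ A) : ℕ∞ :=
  ⨅ (d : ℕ) (_ : DiagDimLE D d), (d : ℕ∞)

end DiagDim

end DiagonalPair

namespace DiagonalPair

open scoped ComplexOrder CStarAlgebra

/-! ### Masas and their normalisers. -/

section Masa

variable {A : Type*} [Ring A] [StarRing A] [Algebra ℂ A] [StarModule ℂ A]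
  {D : StarSubalgebra ℂ A}

/-! Finite diagonal dimension splits `a ≥ 0`, up to `ε`, into finitely many positive pieces `c i`,
the images of the components of `ψ a` under the order zero maps. It is enough to approximate each
piece from a hereditary `H` containing `Φ a`. The tool is the map `Θ y = ∑ k l, v k * Φ((v k)⋆ y (v
l)) * (v l)⋆` with all `v k` normalisers of `D` (`compression`).

On the one hand `Θ` lands in `H`. A Cauchy-Schwarz estimate bounds `Θ z` by a multiple of its
diagonal terms `v k * Φ((v k)⋆ z (v k)) * (v k)⋆`. Conjugation by normalisers commutes with `Φ`
(`expectation_conj`), so these are `g * Φ z * g` with `g = v k * (v k)⋆` in the commutative algebra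
`D`, hence below a multiple of `Φ z`. So `0 ≤ z ≤ a` puts `Θ z` below a multiple of `Φ a`
(`exists_compression_le`).

On the other hand the `v k` can be chosen so that `Θ` is contractive on self-adjoint elements and
almost fixes a given `φ x`, `φ` one of the order zero maps (`exists_compression_near`). In the
finite-dimensional algebra take normalisers `e k` with `∑ k, e k * (e k)⋆ = 1` and every `(e k)⋆ x
(e l)` in the masa (`exists_normaliser_frame`), and put `v k = φ(e k) * (φ 1 + δ)⁻¹`. The identity
`φ x * φ y = φ 1 * φ (x * y)` (`order_zero_mul`) places `(v k)⋆ φ(x) (v l)` in `D`, so `Φ` drops out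
and the sum collapses to `(φ 1 * (φ 1 + δ)⁻¹)⁴ * φ x`.

As `c i` lies only below `a + ε`, it is first moved to a nearby `z ≤ a` (`exists_le_near`); then `Θ
z ∈ H` is close to `c i`. -/

lemma IsMasa.comm (hD : IsMasa D) {x y : A} (hx : x ∈ D) (hy : y ∈ D) : x * y = y * x :=
  hD.prop x hx y hy

lemma IsMasa.mem_of_isSelfAdjoint (hD : IsMasa D) {y : A} (hy : IsSelfAdjoint y)
    (h : ∀ x ∈ D, x * y = y * x) : y ∈ D := by
  have hc : ∀ a ∈ insert y (D : Set A), ∀ b ∈ insert y (D : Set A), a * b = b * a := by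
    rintro a (rfl | ha) b (rfl | hb)
    · rfl
    · exact (h b hb).symm
    · exact h a ha
    · exact hD.comm ha hb
  have hs : ∀ b ∈ insert y (D : Set A), star b ∈ insert y (D : Set A) := by
    rintro b (rfl | hb)
    · exact .inl hy.star_eq
    · exact .inr (star_mem hb)
  have R := StarAlgebra.isMulCommutative_adjoin ℂ (s := insert y (D : Set A)) hc
    (fun a ha b hb => hc a ha _ (hs b hb))
  have hle : D ≤ StarAlgebra.adjoin ℂ (insert y (D : Set A)) := fun x hx =>
    StarAlgebra.subset_adjoin ℂ _ (.inr hx)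
  refine hD.le_of_ge ?_ hle (StarAlgebra.subset_adjoin ℂ _ (.inl rfl))
  intro x hx z hz
  exact congrArg Subtype.val (R.is_comm.comm ⟨x, hx⟩ ⟨z, hz⟩)

lemma IsMasa.mem_of_commute (hD : IsMasa D) {y : A} (h : ∀ x ∈ D, x * y = y * x) : y ∈ D := by
  have h' : ∀ x ∈ D, x * star y = star y * x := fun x hx => by
    have := congrArg star (h (star x) (star_mem hx))
    simpa using this.symm
  have h1 : (realPart y : A) ∈ D := by
    refine hD.mem_of_isSelfAdjoint (realPart y).2 fun x hx => ?_
    simp [realPart_apply_coe, mul_add, add_mul, h x hx, h' x hx]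
  have h2 : (imaginaryPart y : A) ∈ D := by
    refine hD.mem_of_isSelfAdjoint (imaginaryPart y).2 fun x hx => ?_
    simp [imaginaryPart_apply_coe, mul_sub, sub_mul, h x hx, h' x hx]
  rw [← realPart_add_I_smul_imaginaryPart y]
  exact add_mem h1 (SMulMemClass.smul_mem _ h2)

lemma star_mem_normalisers {v : A} (hv : v ∈ normalisers D) : star v ∈ normalisers D :=
  fun _ hx => by simpa only [star_star] using (hv _ hx).symm

lemma mul_mem_normalisers {v w : A} (hv : v ∈ normalisers D) (hw : w ∈ normalisers D) :
    v * w ∈ normalisers D := fun _ hx => by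
  simpa [mul_assoc] using And.intro (hv _ (hw _ hx).1).1 (hw _ (hv _ hx).2).2

lemma mem_normalisers_of_mem {v : A} (hv : v ∈ D) : v ∈ normalisers D := fun _ hx =>
  ⟨mul_mem (mul_mem hv hx) (star_mem hv), mul_mem (mul_mem (star_mem hv) hx) hv⟩

lemma star_mul_self_mem {v : A} (hv : v ∈ normalisers D) : star v * v ∈ D := by
  simpa using (hv 1 (one_mem D)).2

lemma mul_star_self_mem {v : A} (hv : v ∈ normalisers D) : v * star v ∈ D := by
  simpa using (hv 1 (one_mem D)).1

/-- Normalisers are closed under products and adjoints, so their linear span is already a ⋆-algebra;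
linear continuous identities need checking only on normalisers. -/
lemma adjoin_normalisers_le_span :
    (StarAlgebra.adjoin ℂ (normalisers D) : Set A) ⊆ Submodule.span ℂ (normalisers D) := by
  intro x hx
  have hx' : x ∈ Subalgebra.toSubmodule (StarAlgebra.adjoin ℂ (normalisers D)).toSubalgebra := hx
  rw [StarAlgebra.adjoin_eq_span] at hx'
  refine Submodule.span_mono ?_ hx'
  intro y hy
  induction hy using Submonoid.closure_induction with
  | mem z hz =>
    rcases hz with hz | hz
    · exact hz
    · simpa using star_mem_normalisers hz
  | one => exact mem_normalisers_of_mem (one_mem D)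
  | mul a b _ _ ha hb => exact mul_mem_normalisers ha hb

end Masa

/-! ### Equivariance of the expectation under normalisers. -/

section CStar

variable {A : Type*} [CStarAlgebra A] [PartialOrder A] {D : StarSubalgebra ℂ A}

/-- A conditional expectation `Φ` onto a masa satisfies `Φ(u)⋆ u = Φ(u)⋆ Φ(u)` at every
normaliser `u`. -/
lemma star_expectation_mul_normaliser (hD : IsMasa D) {Φ : A →ₗ[ℂ] D}
    (hΦ : IsConditionalExpectation D Φ) {u : A} (hu : u ∈ normalisers D) :
    star (Φ u : A) * u = star (Φ u : A) * (Φ u : A) := by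
  set E : A := (Φ u : A) with hE
  have hED : E ∈ D := (Φ u).2
  -- Apply `Φ` to both sides of `u (u⋆u x) = (u x u⋆) u` and pull the factors in `D` out.
  have key : ∀ x ∈ D, u * x * star u * E = star u * u * x * E := by
    intro x hx
    have h1 : u * (star u * u * x) = (u * x * star u) * u := by
      rw [hD.comm (star_mul_self_mem hu) hx]; noncomm_ring
    have h2 := hΦ.bimodule 1 ⟨star u * u * x, mul_mem (star_mul_self_mem hu) hx⟩ u
    have h3 := hΦ.bimodule ⟨u * x * star u, (hu x hx).1⟩ 1 u
    simp only [OneMemClass.coe_one, one_mul, mul_one] at h2 h3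
    rw [h1, h3] at h2
    have h4 := congrArg (Subtype.val : D → A) h2
    simp only [MulMemClass.coe_mul] at h4
    rw [← hE] at h4
    rw [h4, hD.comm hED (mul_mem (star_mul_self_mem hu) hx)]
  have hcomm : ∀ x ∈ D, star E * (x * u - u * x) = 0 := by
    intro x hx
    have hxs : star x ∈ D := star_mem hx
    have e0 : (u * star u) * E = star u * u * E := by simpa using key 1 (one_mem D)
    have e1 : star x * E = E * star x := hD.comm hxs hED
    have e2 := key x hx
    have e3 := key (star x) hxs
    have e4 := key (x * star x) (mul_mem hx hxs)
    have e5 : x * (star u * u) = star u * u * x := hD.comm hx (star_mul_self_mem hu)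
    -- By `key` at `1`, `x`, `star x` and `x * star x`, the four terms of the expansion cancel.
    have hW : (x * u - u * x) * star (x * u - u * x) * E = 0 := by
      calc (x * u - u * x) * star (x * u - u * x) * E
          = x * (u * star u) * (star x * E) - x * (u * star x * star u * E)
            - (u * x * star u) * (star x * E) + u * (x * star x) * star u * E := by
              simp only [star_sub, star_mul]; noncomm_ring
        _ = x * ((u * star u) * E) * star x - x * (u * star x * star u * E)
            - (u * x * star u * E) * star x + u * (x * star x) * star u * E := by
              rw [e1]; noncomm_ring
        _ = (x * (star u * u)) * (E * star x) - (x * (star u * u)) * (star x * E)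
            - star u * u * x * (E * star x) + star u * u * x * (star x * E) := by
              rw [e0, e2, e3, e4]; noncomm_ring
        _ = 0 := by rw [e5, e1]; noncomm_ring
    rw [← CStarRing.mul_star_self_eq_zero_iff]
    calc star E * (x * u - u * x) * star (star E * (x * u - u * x))
        = star E * ((x * u - u * x) * star (x * u - u * x) * E) := by
          simp only [star_mul, star_star, mul_assoc]
      _ = 0 := by rw [hW, mul_zero]
  have hmem : star E * u ∈ D := by
    refine hD.mem_of_commute fun x hx => ?_
    have h := hcomm x hx
    rw [mul_sub, sub_eq_zero] at h
    rw [← mul_assoc, hD.comm hx (star_mem hED), mul_assoc, h, mul_assoc]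
  have h1 := hΦ.apply_coe ⟨_, hmem⟩
  have h2 := hΦ.bimodule ⟨star E, star_mem hED⟩ 1 u
  simp only [OneMemClass.coe_one, mul_one] at h2
  rw [h2] at h1
  exact (congrArg (Subtype.val : D → A) h1).symm

lemma IsConditionalExpectation.map_mul_left {Φ : A →ₗ[ℂ] D} (hΦ : IsConditionalExpectation D Φ)
    {x : A} (hx : x ∈ D) (a : A) : (Φ (x * a) : A) = x * Φ a := by
  simpa using congrArg (Subtype.val : D → A) (hΦ.bimodule ⟨x, hx⟩ 1 a)

lemma IsConditionalExpectation.map_mul_right {Φ : A →ₗ[ℂ] D} (hΦ : IsConditionalExpectation D Φ)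
    {x : A} (hx : x ∈ D) (a : A) : (Φ (a * x) : A) = Φ a * x := by
  simpa using congrArg (Subtype.val : D → A) (hΦ.bimodule 1 ⟨x, hx⟩ a)

lemma IsConditionalExpectation.map_mem {Φ : A →ₗ[ℂ] D} (hΦ : IsConditionalExpectation D Φ)
    {x : A} (hx : x ∈ D) : (Φ x : A) = x :=
  congrArg (Subtype.val : D → A) (hΦ.apply_coe ⟨x, hx⟩)

/-- With `P` and `Q` the two sides, `Φ(u)⋆ u = Φ(u)⋆ Φ(u)`, used at `u` and at `v⋆ u v`, gives `Q⋆P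
= Q⋆Q` and the analogous relation for `P⋆` cut down by `v⋆v`. Hence `R = P - Q` satisfies `v R = 0`.
Since `Q` and the argument of `Φ` in `P` both begin with `v⋆`, this yields `R⋆P = R⋆Q = 0`, so `R⋆R
= 0`. -/
lemma expectation_conj_normaliser (hD : IsMasa D) {Φ : A →ₗ[ℂ] D}
    (hΦ : IsConditionalExpectation D Φ) {u v : A} (hu : u ∈ normalisers D)
    (hv : v ∈ normalisers D) :
    (Φ (star v * u * v) : A) = star v * Φ u * v := by
  set P : A := (Φ (star v * u * v) : A) with hP
  set E : A := (Φ u : A) with hE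
  have hED : E ∈ D := (Φ u).2
  have hPD : P ∈ D := (Φ _).2
  have hQD : star v * E * v ∈ D := (hv E hED).2
  have hu' : star v * u * v ∈ normalisers D :=
    mul_mem_normalisers (mul_mem_normalisers (star_mem_normalisers hv) hu) hv
  have hg := star_mul_self_mem hv
  have hg' := mul_star_self_mem hv
  have fu := star_expectation_mul_normaliser hD hΦ hu
  have fu' := star_expectation_mul_normaliser hD hΦ hu'
  rw [← hP] at fu'
  rw [← hE] at fu
  set Q : A := star v * E * v with hQ
  have hsQ : star Q = star v * star E * v := by simp [hQ, mul_assoc]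
  have h1 : star Q * P = star Q * Q := by
    rw [hP, ← hΦ.map_mul_left (star_mem hQD)]
    have : star Q * (star v * u * v) = star Q * Q := by
      rw [hsQ, hQ]
      calc star v * star E * v * (star v * u * v)
          = star v * (star E * (v * star v)) * u * v := by noncomm_ring
        _ = star v * (v * star v) * (star E * u) * v := by
            rw [hD.comm (star_mem hED) hg']; noncomm_ring
        _ = star v * ((v * star v) * star E) * E * v := by rw [fu]; noncomm_ring
        _ = star v * star E * v * (star v * E * v) := by
            rw [← hD.comm (star_mem hED) hg']; noncomm_ring
    rw [this, hΦ.map_mem (mul_mem (star_mem hQD) hQD)]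
  have h2 : (star v * v) * star P * Q * (star v * v) = (star v * v) * star P * P * (star v * v) := by
    -- Sandwich `fu'` between `v` and `v⋆`; applying `Φ` then trades `u` for `E`.
    have e1 : (v * star P * star v) * u * (v * star v) = v * (star P * P) * star v := by
      rw [← fu']; noncomm_ring
    have e2 := hΦ.map_mul_right hg' ((v * star P * star v) * u)
    rw [hΦ.map_mul_left (hv _ (star_mem hPD)).1, e1,
      hΦ.map_mem (hv _ (mul_mem (star_mem hPD) hPD)).1] at e2
    calc (star v * v) * star P * Q * (star v * v)
        = star v * (v * star P * star v * E * (v * star v)) * v := by rw [hQ]; noncomm_ring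
      _ = (star v * v) * star P * P * (star v * v) := by rw [← e2]; noncomm_ring
  set R : A := P - Q with hR
  have hRD : R ∈ D := sub_mem hPD hQD
  have hgR : star v * v * R = 0 := by
    have h3 : (star v * v) * star P * R * (star v * v) = 0 := by
      rw [hR, mul_sub, sub_mul, h2, sub_self]
    have h4 : star Q * R = 0 := by rw [hR, mul_sub, h1, sub_self]
    have h5 : star v * v * star R * R * (star v * v) = 0 := by
      have : star R = star P - star Q := by simp [hR]
      calc star v * v * star R * R * (star v * v)
          = (star v * v) * star P * R * (star v * v)
            - (star v * v) * (star Q * R) * (star v * v) := by rw [this]; noncomm_ring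
        _ = 0 := by rw [h3, h4]; simp
    rw [hD.comm hg hRD, ← CStarRing.star_mul_self_eq_zero_iff]
    simpa [mul_assoc] using h5
  have hvR : v * R = 0 := by
    rw [← CStarRing.star_mul_self_eq_zero_iff, star_mul]
    calc star R * star v * (v * R) = star R * (star v * v * R) := by noncomm_ring
      _ = 0 := by rw [hgR, mul_zero]
  have hRv : star R * star v = 0 := by rw [← star_mul, hvR, star_zero]
  have : star R * R = 0 := by
    have a1 : star R * Q = 0 := by rw [hQ, ← mul_assoc, ← mul_assoc, hRv]; simp
    have a2 : star R * P = 0 := by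
      rw [hP, ← hΦ.map_mul_left (star_mem hRD), ← mul_assoc, ← mul_assoc, hRv]; simp
    rw [hR, mul_sub, ← hR, a1, a2, sub_zero]
  exact sub_eq_zero.mp (CStarRing.star_mul_self_eq_zero_iff _ |>.mp this)

variable [StarOrderedRing A]

/-- A positive normaliser of a closed ⋆-subalgebra `D` lies in `D`. -/
lemma mem_of_nonneg_of_mem_normalisers (hcl : IsClosed (D : Set A)) {v : A} (h0 : 0 ≤ v)
    (hv : v ∈ normalisers D) : v ∈ D := by
  have h1 : star v * v ∈ D := star_mul_self_mem hv
  rw [(IsSelfAdjoint.of_nonneg h0).star_eq] at h1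
  have h0' : 0 ≤ v * v := by
    simpa [(IsSelfAdjoint.of_nonneg h0).star_eq] using star_mul_self_nonneg v
  rw [← CFC.sqrt_mul_self v h0, CFC.sqrt_eq_real_sqrt _ h0']
  have : IsClosed (D : Set A) := hcl
  exact cfcₙ_mem (𝕜' := ℂ) _ h1

lemma IsConditionalExpectation.continuous {Φ : A →ₗ[ℂ] D} (hΦ : IsConditionalExpectation D Φ) :
    Continuous fun a => (Φ a : A) := by
  let f : A →ₗ[ℂ] A := D.subtype.toLinearMap ∘ₗ Φ
  let g : A →ₚ[ℂ] A := PositiveLinearMap.mk₀ f hΦ.nonneg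
  exact map_continuous g

/-- The expectation of a Cartan pair is equivariant under conjugation by normalisers. -/
lemma expectation_conj (hD : IsCartanPair D) {Φ : A →ₗ[ℂ] D}
    (hΦ : IsConditionalExpectation D Φ) {v : A} (hv : v ∈ normalisers D) (y : A) :
    (Φ (star v * y * v) : A) = star v * Φ y * v := by
  have hc := hΦ.continuous
  -- Both sides are linear and continuous in `y`, and the normalisers have dense span.
  have hclosed : IsClosed {y : A | (Φ (star v * y * v) : A) = star v * Φ y * v} :=
    isClosed_eq (hc.comp (by fun_prop)) (by fun_prop)
  have hspan : ∀ y ∈ Submodule.span ℂ (normalisers D),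
      (Φ (star v * y * v) : A) = star v * Φ y * v := by
    intro y hy
    induction hy using Submodule.span_induction with
    | mem u hu => exact expectation_conj_normaliser hD.masa hΦ hu hv
    | zero => simp
    | add a b _ _ ha hb => simp [mul_add, add_mul, ha, hb]
    | smul c a _ ha => simp [ha]
  have hy : y ∈ ((StarAlgebra.adjoin ℂ (normalisers D)).topologicalClosure : Set A) := by
    rw [hD.regular]; trivial
  rw [StarSubalgebra.topologicalClosure_coe] at hy
  exact closure_minimal (fun z hz => hspan z (adjoin_normalisers_le_span hz)) hclosed hy

end CStar

/-! ### Structure of completely positive order zero maps on finite-dimensional algebras. -/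

section OrderZero

lemma finite_real_spectrum {F : Type*} [Ring F] [Algebra ℝ F] [FiniteDimensional ℝ F] (x : F) :
    (spectrum ℝ x).Finite := by
  rcases subsingleton_or_nontrivial F with h | h
  · simp [spectrum.of_subsingleton]
  have hx : IsIntegral ℝ x := IsIntegral.of_finite ℝ x
  refine ((minpoly ℝ x).rootSet_finite ℝ).subset fun t ht => ?_
  rw [Polynomial.mem_rootSet_of_ne (minpoly.ne_zero hx)]
  have := spectrum.subset_polynomial_aeval x (minpoly ℝ x) ⟨t, ht, rfl⟩
  rw [minpoly.aeval, spectrum.zero_eq] at this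
  simpa [Polynomial.aeval_def] using this

/-- Spectral decomposition of a self-adjoint element with finite spectrum. -/
lemma exists_spectral_decomposition {F : Type*} [CStarAlgebra F] {x : F} (hx : IsSelfAdjoint x)
    (hfin : (spectrum ℝ x).Finite) :
    ∃ (s : Finset ℝ) (p : ℝ → F), (∀ t, IsSelfAdjoint (p t)) ∧ (∀ t, p t * p t = p t) ∧
      (∀ t u, t ≠ u → p t * p u = 0) ∧ x = ∑ t ∈ s, (t : ℂ) • p t := by
  have hc : ∀ f : ℝ → ℝ, ContinuousOn f (spectrum ℝ x) := fun f => hfin.continuousOn f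
  let i : ℝ → ℝ → ℝ := fun t u => if u = t then 1 else 0
  refine ⟨hfin.toFinset, fun t => cfc (i t) x, fun t => cfc_predicate _ _, fun t => ?_,
    fun t u htu => ?_, ?_⟩
  · rw [← cfc_mul _ _ _ (hc _) (hc _)]
    congr 1
    ext u
    by_cases h : u = t <;> simp [i, h]
  · rw [← cfc_mul _ _ _ (hc _) (hc _), ← cfc_const_zero ℝ x]
    congr 1
    ext w
    by_cases h : w = t
    · subst h; simp [i, htu]
    · simp [i, h]
  · have h1 : ∀ t : ℝ, (t : ℂ) • cfc (i t) x = cfc (fun u => t * i t u) x := fun t => by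
      rw [cfc_const_mul _ _ _ (hc _), Complex.coe_smul]
    simp only [h1]
    rw [← cfc_sum _ _ _ (fun t _ => hc _)]
    conv_lhs => rw [← cfc_id ℝ x]
    refine cfc_congr fun u hu => ?_
    simp [i, Finset.sum_apply, hu]

variable {F A : Type*} [CStarAlgebra F] [PartialOrder F] [StarOrderedRing F]
  [CStarAlgebra A] [PartialOrder A] [StarOrderedRing A]

lemma exists_eq_star_mul_self {B : Type*} [NonUnitalCStarAlgebra B] [PartialOrder B]
    [StarOrderedRing B] {b : B} (hb : 0 ≤ b) : ∃ s : B, b = star s * s :=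
  CStarAlgebra.nonneg_iff_eq_star_mul_self.mp hb

/-- Compressing a positive matrix by a column gives a positive element. -/
lemma sum_star_mul_mul_nonneg {n : Type*} [Fintype n] {M : CStarMatrix n n A} (hM : 0 ≤ M)
    (b : n → A) : 0 ≤ ∑ k, ∑ l, star (b k) * M k l * b l := by
  obtain ⟨S, rfl⟩ := exists_eq_star_mul_self hM
  have : ∑ k, ∑ l, star (b k) * (star S * S) k l * b l
      = ∑ m, star (∑ k, S m k * b k) * (∑ l, S m l * b l) := by
    simp only [CStarMatrix.mul_apply, CStarMatrix.star_apply, star_sum, star_mul,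
      Finset.mul_sum, Finset.sum_mul, mul_assoc]
    rw [Finset.sum_congr rfl fun k _ => Finset.sum_comm, Finset.sum_comm]
    exact Finset.sum_congr rfl fun m _ => Finset.sum_comm
  rw [this]
  exact Finset.sum_nonneg fun m _ => star_mul_self_nonneg _

lemma sum_star_mul_map_mul_nonneg {n : Type*} [Fintype n] (φ : F →CP A) (x : n → F) (b : n → A) :
    0 ≤ ∑ k, ∑ l, star (b k) * φ (star (x k) * x l) * b l := by
  classical
  rcases isEmpty_or_nonempty n with h | ⟨⟨m₀⟩⟩
  · simp
  -- A matrix whose only nonzero row is `x`, so that `star R * R` has entries `star (x k) * x l`.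
  let R : CStarMatrix n n F := CStarMatrix.ofMatrix fun m k => if m = m₀ then x k else 0
  have hR : 0 ≤ (star R * R).map φ := φ.map_cstarMatrix_nonneg _ (star_mul_self_nonneg R)
  have := sum_star_mul_mul_nonneg hR b
  have e : ∀ k l, ((star R * R).map φ) k l = φ (star (x k) * x l) := fun k l => by
    have e' : ∀ m k, R m k = if m = m₀ then x k else 0 := fun _ _ => rfl
    simp [CStarMatrix.mul_apply, CStarMatrix.star_apply, e', apply_ite]
  simpa only [e] using this


section

variable {φ : F →CP A}

/-- The defining identities of an order zero map at a projection. -/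
lemma order_zero_projection (hφ : IsOrderZero φ.toLinearMap) {p : F} (hp : IsSelfAdjoint p)
    (hpp : p * p = p) : φ p * φ 1 = φ p * φ p ∧ φ 1 * φ p = φ p * φ p := by
  have h0 : 0 ≤ p := by simpa [hp.star_eq, hpp] using star_mul_self_nonneg p
  have h1 : 0 ≤ 1 - p := by
    have := star_mul_self_nonneg (1 - p)
    rwa [star_sub, star_one, hp.star_eq, mul_sub, sub_mul, sub_mul, hpp, one_mul, mul_one,
      one_mul, sub_self, sub_zero] at this
  have h2 : φ p * φ (1 - p) = 0 := hφ p (1 - p) h0 h1 (by rw [mul_sub, hpp]; simp)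
  have h3 : φ (1 - p) * φ p = 0 := hφ (1 - p) p h1 h0 (by rw [sub_mul, hpp]; simp)
  rw [map_sub, mul_sub, sub_eq_zero] at h2
  rw [map_sub, sub_mul, sub_eq_zero] at h3
  exact ⟨h2, h3⟩

lemma le_norm_smul_map_one (φ : F →CP A) {x : F} (hx : IsSelfAdjoint x) :
    φ x ≤ (‖x‖ : ℂ) • φ 1 := by
  rw [← map_smul]
  refine OrderHomClass.mono φ ?_
  simpa [Algebra.algebraMap_eq_smul_one] using IsSelfAdjoint.le_algebraMap_norm_self hx

/-- From `0 ≤ φ x ≤ ‖x‖ φ 1` follows `b⋆ φ(x) b ≤ ‖x‖ b⋆ φ(1) b = 0`. -/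
lemma map_mul_eq_zero_of_nonneg (φ : F →CP A) {b : A} (hb : φ 1 * b = 0) {x : F} (hx : 0 ≤ x) :
    φ x * b = 0 := by
  have h1 : 0 ≤ φ x := map_nonneg φ hx
  obtain ⟨s, hs⟩ := exists_eq_star_mul_self h1
  have h2 : star b * φ x * b ≤ star b * ((‖x‖ : ℂ) • φ 1) * b :=
    star_left_conjugate_le_conjugate (le_norm_smul_map_one φ (.of_nonneg hx)) b
  have h3 : star b * ((‖x‖ : ℂ) • φ 1) * b = 0 := by
    rw [mul_assoc, smul_mul_assoc, hb]; simp
  have h4 : star (s * b) * (s * b) = 0 := by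
    refine le_antisymm ?_ (star_mul_self_nonneg _)
    rw [h3, hs] at h2
    simpa [mul_assoc] using h2
  rw [CStarRing.star_mul_self_eq_zero_iff] at h4
  rw [hs, mul_assoc, h4, mul_zero]

lemma map_mul_eq_zero (φ : F →CP A) {b : A} (hb : φ 1 * b = 0) (x : F) : φ x * b = 0 := by
  obtain ⟨y, hy, -, hxy⟩ := CStarAlgebra.exists_sum_four_nonneg x
  rw [hxy]
  simp only [map_sum, map_smul, Finset.sum_mul, smul_mul_assoc,
    map_mul_eq_zero_of_nonneg φ hb (hy _), smul_zero, Finset.sum_const_zero]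

variable [FiniteDimensional ℂ F]

/-- Spectral decomposition reduces both identities to mutually orthogonal projections, where order
zero applies to `p` and `1 - p` and to distinct pairs. -/
lemma order_zero_isSelfAdjoint (hφ : IsOrderZero φ.toLinearMap) {x : F} (hx : IsSelfAdjoint x) :
    φ x * φ 1 = φ 1 * φ x ∧ φ x * φ x = φ 1 * φ (x * x) := by
  have : FiniteDimensional ℝ F := Module.Finite.trans ℂ F
  obtain ⟨s, p, hp, hpp, horth, rfl⟩ := exists_spectral_decomposition hx (finite_real_spectrum x)
  have hpos : ∀ t, 0 ≤ p t := fun t => by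
    simpa [(hp t).star_eq, hpp] using star_mul_self_nonneg (p t)
  have h := fun t => order_zero_projection hφ (hp t) (hpp t)
  have horth' : ∀ t u, t ≠ u → φ (p t) * φ (p u) = 0 := fun t u htu =>
    hφ _ _ (hpos t) (hpos u) (horth t u htu)
  constructor
  · simp only [map_sum, map_smul, Finset.sum_mul, Finset.mul_sum, smul_mul_assoc, mul_smul_comm,
      (h _).1, (h _).2]
  · simp only [Finset.sum_mul, Finset.mul_sum, smul_mul_assoc, mul_smul_comm, map_sum, map_smul]
    refine Finset.sum_congr rfl fun t ht => ?_
    rw [Finset.sum_eq_single t (fun u _ hut => by rw [horth' u t hut]; simp)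
      (fun h => absurd ht h), Finset.sum_eq_single t (fun u _ hut => by rw [horth u t hut]; simp)
      (fun h => absurd ht h), hpp, (h t).2]

lemma order_zero_commute (hφ : IsOrderZero φ.toLinearMap) (x : F) : φ x * φ 1 = φ 1 * φ x := by
  rw [← realPart_add_I_smul_imaginaryPart x]
  simp only [map_add, map_smul, add_mul, mul_add, smul_mul_assoc, mul_smul_comm,
    (order_zero_isSelfAdjoint hφ (realPart x).2).1,
    (order_zero_isSelfAdjoint hφ (imaginaryPart x).2).1]

/-- The Jordan identity for order zero maps. -/
lemma order_zero_jordan (hφ : IsOrderZero φ.toLinearMap) (x : F) :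
    φ (star x) * φ x + φ x * φ (star x) = φ 1 * φ (star x * x + x * star x) := by
  have hr := (order_zero_isSelfAdjoint hφ (realPart x).2).2
  have hi := (order_zero_isSelfAdjoint hφ (imaginaryPart x).2).2
  set r : F := (realPart x : F) with hr'
  set i : F := (imaginaryPart x : F) with hi'
  have hx : x = r + Complex.I • i := (realPart_add_I_smul_imaginaryPart x).symm
  have hxs : star x = r - Complex.I • i := by
    conv_lhs => rw [hx]
    have h1 : star r = r := (realPart x).2
    have h2 : star i = i := (imaginaryPart x).2
    rw [star_add, star_smul, h1, h2]; simp [sub_eq_add_neg]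
  have e1 : star x * x + x * star x = (2 : ℂ) • (r * r + i * i) := by
    rw [hxs, hx]
    simp only [sub_mul, mul_add, add_mul, mul_sub, smul_mul_assoc, mul_smul_comm]
    match_scalars <;> ring_nf
    norm_num [Complex.I_sq]
  have e2 : φ (star x) * φ x + φ x * φ (star x) = (2 : ℂ) • (φ r * φ r + φ i * φ i) := by
    rw [hxs, hx]
    simp only [map_sub, map_add, map_smul, sub_mul, mul_add, add_mul, mul_sub, smul_mul_assoc,
      mul_smul_comm]
    match_scalars <;> ring_nf
    norm_num [Complex.I_sq]
  rw [e1, e2, hr, hi, map_smul, map_add, mul_smul_comm, mul_add]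

/-- The structure identity for completely positive order zero maps. -/
lemma order_zero_star_mul_self (hφ : IsOrderZero φ.toLinearMap) (x : F) :
    φ (star x) * φ x = φ 1 * φ (star x * x) := by
  have hh : star (φ 1) = φ 1 := by rw [← map_star, star_one]
  have hcomm := order_zero_commute hφ
  -- Two-positivity on the row `(x, 1)`, tested on the column `(φ 1, -φ x)`; the last two of the
  -- four terms cancel because `φ 1` commutes with the image.
  have pos : ∀ x : F, 0 ≤ φ 1 * (φ 1 * φ (star x * x) - φ (star x) * φ x) := by
    intro x
    have h := sum_star_mul_map_mul_nonneg φ ![x, 1] ![φ 1, - φ x]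
    simp only [Fin.sum_univ_two, Matrix.cons_val_zero, Matrix.cons_val_one, star_one, mul_one,
      one_mul, star_neg, hh] at h
    convert h using 1
    rw [← map_star]
    calc φ 1 * (φ 1 * φ (star x * x) - φ (star x) * φ x)
        = φ 1 * (φ 1 * φ (star x * x)) - φ 1 * φ (star x) * φ x := by noncomm_ring
      _ = φ 1 * (φ (star x * x) * φ 1) - φ 1 * φ (star x) * φ x := by rw [hcomm]
      _ = φ 1 * φ (star x * x) * φ 1 - φ 1 * φ (star x) * φ x - φ (star x) * (φ x * φ 1)
          + φ (star x) * (φ 1 * φ x) := by rw [hcomm x]; noncomm_ring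
      _ = _ := by noncomm_ring
  set Y := φ 1 * φ (star x * x) - φ (star x) * φ x with hY
  have hY1 : 0 ≤ φ 1 * Y := pos x
  -- By the Jordan identity, replacing `x` by `star x` changes the sign of the defect `Y`.
  have hY2 : 0 ≤ φ 1 * (-Y) := by
    have h := pos (star x)
    rw [star_star] at h
    convert h using 2
    have := order_zero_jordan hφ x
    rw [map_add, mul_add] at this
    rw [hY, neg_sub, sub_eq_sub_iff_add_eq_add, this, add_comm]
  have hY0 : φ 1 * Y = 0 := by
    refine le_antisymm ?_ hY1
    rwa [mul_neg, Left.nonneg_neg_iff] at hY2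
  have hsY : star Y = Y := by
    rw [hY, star_sub, star_mul, star_mul, map_star φ x, star_star, ← map_star φ (star x * x), hh,
      hcomm]
    simp
  -- `φ 1 * Y = 0` forces `φ(y) * Y = 0` for every `y`, and `Y` itself is built from values of `φ`.
  have hYY : star Y * Y = 0 := by
    have := map_mul_eq_zero φ hY0
    rw [hsY]
    conv_lhs => enter [1]; rw [hY]
    rw [sub_mul, mul_assoc, mul_assoc, this, this]; simp
  rw [CStarRing.star_mul_self_eq_zero_iff] at hYY
  exact (sub_eq_zero.mp hYY).symm

lemma order_zero_mul (hφ : IsOrderZero φ.toLinearMap) (x y : F) :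
    φ x * φ y = φ 1 * φ (x * y) := by
  have key : ∀ x y : F, φ (star x) * φ y = φ 1 * φ (star x * y) := by
    intro x y
    let T : F → F → A := fun x y => φ (star x) * φ y - φ 1 * φ (star x * y)
    have hT : ∀ x, T x x = 0 := fun x => sub_eq_zero.mpr (order_zero_star_mul_self hφ x)
    have h1 : T x y + T y x = 0 := by
      have : T (x + y) (x + y) = T x x + T y y + (T x y + T y x) := by
        simp only [T, star_add, map_add, add_mul, mul_add]; abel
      simpa [hT] using this.symm
    have h2 : Complex.I • (T x y - T y x) = 0 := by
      have : T (x + Complex.I • y) (x + Complex.I • y)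
          = T x x + T y y + Complex.I • (T x y - T y x) := by
        simp only [T, star_add, star_smul, map_add, map_smul, add_mul, mul_add, smul_mul_assoc,
          mul_smul_comm, Complex.star_def, Complex.conj_I]
        match_scalars <;> ring_nf <;> norm_num [Complex.I_sq]
      simpa [hT] using this.symm
    have h3 : T x y - T y x = 0 := (smul_eq_zero.mp h2).resolve_left Complex.I_ne_zero
    have h4 : (2 : ℂ) • T x y = 0 := by
      have : (2 : ℂ) • T x y = (T x y + T y x) + (T x y - T y x) := by module
      rw [this, h1, h3, add_zero]
    exact sub_eq_zero.mp ((smul_eq_zero.mp h4).resolve_left two_ne_zero)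
  simpa using key (star x) y

end

end OrderZero

/-! ### Normaliser frames in finite-dimensional algebras. -/

section FiniteDimensional

/-- The minimal projections of a finite-dimensional commutative C⋆-algebra. -/
lemma exists_minimal_projections (B : Type*) [CommCStarAlgebra B] [FiniteDimensional ℂ B] :
    ∃ (n : ℕ) (p : Fin n → B) (χ : Fin n → B → ℂ), (∀ k, star (p k) = p k) ∧
      (∀ k, p k * p k = p k) ∧ (∀ k, p k ≠ 0) ∧ (∑ k, p k = 1) ∧
      (∀ k x, x * p k = χ k x • p k) := by
  classical
  -- Distinct characters are linearly independent, so the spectrum is finite and discrete; the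
  -- projections are its point indicators.
  have hfin : Finite (WeakDual.characterSpace ℂ B) := by
    have : Finite (B →ₐ[ℂ] ℂ) := (linearIndependent_toLinearMap ℂ B ℂ).finite
    exact Finite.of_equiv _ WeakDual.CharacterSpace.equivAlgHom.symm
  let X := WeakDual.characterSpace ℂ B
  obtain ⟨n, ⟨e⟩⟩ := Finite.exists_equiv_fin X
  let G := gelfandStarTransform B
  have : DiscreteTopology X := inferInstance
  let f : Fin n → C(X, ℂ) := fun k => ⟨fun y => if y = e.symm k then 1 else 0, continuous_of_discreteTopology⟩
  have hf : ∀ k y, f k y = if y = e.symm k then 1 else 0 := fun _ _ => rfl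
  have hG : ∀ k, G (G.symm (f k)) = f k := fun k => G.apply_symm_apply _
  refine ⟨n, fun k => G.symm (f k), fun k x => G x (e.symm k), fun k => ?_, fun k => ?_,
    fun k hk => ?_, ?_, fun k x => ?_⟩
  · rw [← map_star]
    congr 1
    ext y
    simp [hf, apply_ite]
  · rw [← map_mul]
    congr 1
    ext y
    simp [hf]
  · have := congrArg (fun z => G z (e.symm k)) hk
    simp [hG, hf] at this
  · rw [← map_sum, ← map_one G.symm]
    congr 1
    ext y
    simp only [ContinuousMap.coe_sum, Finset.sum_apply, hf, ContinuousMap.one_apply]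
    rw [Finset.sum_eq_single (e y)]
    · simp
    · intro k _ hk
      rw [if_neg]
      rintro rfl
      simp at hk
    · simp
  · apply EquivLike.injective G
    rw [map_mul, map_smul, hG]
    ext y
    by_cases h : y = e.symm k <;> simp [hf, h]

variable {F : Type*} [CStarAlgebra F] [PartialOrder F] [StarOrderedRing F]
  [FiniteDimensional ℂ F] {D : StarSubalgebra ℂ F}

/-- A masa in a finite-dimensional C⋆-algebra has normalisers `e k` with `∑ k, e k * (e k)⋆ = 1`
that compress the algebra into the masa. -/
lemma exists_normaliser_frame (hD : IsMasa D) :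
    ∃ (n : ℕ) (e : Fin n → F), (∀ k, e k ∈ normalisers D) ∧ (∑ k, e k * star (e k) = 1) ∧
      ∀ k l x, star (e k) * x * e l ∈ D := by
  classical
  have hcl : IsClosed (D : Set F) :=
    Submodule.closed_of_finiteDimensional (Subalgebra.toSubmodule D.toSubalgebra)
  have : FiniteDimensional ℂ D :=
    FiniteDimensional.finiteDimensional_submodule (Subalgebra.toSubmodule D.toSubalgebra)
  let : CommCStarAlgebra D :=
    { StarSubalgebra.cstarAlgebra D with mul_comm := fun x y => Subtype.ext (hD.comm x.2 y.2) }
  obtain ⟨n, P, χ', hPs, hPP, hP0, hPsum, hPχ⟩ := exists_minimal_projections D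
  let p : Fin n → F := fun k => P k
  let χ : Fin n → D → ℂ := χ'
  have hpD : ∀ k, p k ∈ D := fun k => (P k).2
  have hps : ∀ k, star (p k) = p k := fun k => congrArg Subtype.val (hPs k)
  have hpp : ∀ k, p k * p k = p k := fun k => congrArg Subtype.val (hPP k)
  have hp0 : ∀ k, p k ≠ 0 := fun k h => hP0 k (Subtype.ext h)
  have hpsum : ∑ k, p k = 1 := by
    have := congrArg (D.subtype) hPsum
    rw [map_sum] at this
    simpa using this
  have hpχ : ∀ k (x : D), (x : F) * p k = χ k x • p k := fun k x => congrArg Subtype.val (hPχ k x)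
  have hpχ' : ∀ k (x : D), p k * (x : F) = χ k x • p k := fun k x => by
    rw [hD.comm (hpD k) x.2, hpχ]
  -- corners are one-dimensional
  have corner : ∀ k x, ∃ c : ℂ, p k * x * p k = c • p k := by
    intro k x
    have hmem : p k * x * p k ∈ D := by
      refine hD.mem_of_commute fun y hy => ?_
      have h1 := hpχ k ⟨y, hy⟩
      have h2 := hpχ' k ⟨y, hy⟩
      simp only at h1 h2
      rw [← mul_assoc, ← mul_assoc, h1, mul_assoc (p k * x), h2]
      simp [mul_assoc]
    refine ⟨χ k ⟨_, hmem⟩, ?_⟩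
    rw [← hpχ k ⟨_, hmem⟩]
    simp [mul_assoc, hpp]
  -- a nonzero element of `p k F p l` rescales to a partial isometry
  have iso : ∀ k l x, p k * x * p l ≠ 0 →
      ∃ e, p k * e = e ∧ e * p l = e ∧ e * star e = p k ∧ star e * e = p l := by
    intro k l x hx
    set y := p k * x * p l with hy
    have hky : p k * y = y := by rw [hy, ← mul_assoc, ← mul_assoc, hpp]
    have hyl : y * p l = y := by rw [hy, mul_assoc, hpp]
    clear_value y
    have hyl' : p l * star y = star y := by rw [← hps l, ← star_mul, hyl]
    obtain ⟨c, hc⟩ : ∃ c : ℂ, star y * y = c • p l := by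
      obtain ⟨c, hc⟩ := corner l (star y * y)
      exact ⟨c, by rw [← hc, mul_assoc, mul_assoc, hyl, ← mul_assoc, hyl']⟩
    have hc0 : c ≠ 0 := by
      rintro rfl
      rw [zero_smul, CStarRing.star_mul_self_eq_zero_iff] at hc
      exact hx hc
    have hcr : (c.re : ℂ) = c := by
      have h1 : star (star y * y) = star y * y := by simp
      rw [hc, star_smul, hps] at h1
      exact Complex.conj_eq_iff_re.mp (smul_left_injective ℂ (hp0 l) h1)
    have hpl : 0 ≤ p l := by simpa [hps, hpp] using star_mul_self_nonneg (p l)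
    have hcpos : 0 < c.re := by
      by_contra! hle
      have h1 : 0 ≤ c • p l := hc ▸ star_mul_self_nonneg y
      have h2 : 0 ≤ (-c) • p l := by
        refine smul_nonneg ?_ hpl
        rw [← hcr]
        exact_mod_cast neg_nonneg.mpr hle
      rw [neg_smul, Left.nonneg_neg_iff] at h2
      exact (smul_ne_zero hc0 (hp0 l)) (le_antisymm h2 h1)
    -- Here `star y * y = c • p l` with `c > 0`, so scaling by `c^(-1/2)` gives a partial isometry.
    let t : ℂ := ((Real.sqrt c.re)⁻¹ : ℝ)
    have ht : star t = t := Complex.conj_ofReal _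
    have htc : t * t * c = 1 := by
      rw [← hcr]
      simp only [t]
      norm_cast
      rw [← mul_inv, Real.mul_self_sqrt hcpos.le, inv_mul_cancel₀ hcpos.ne']
    have hee : star (t • y) * (t • y) = p l := by
      rw [star_smul, ht, smul_mul_smul_comm, hc, smul_smul, htc, one_smul]
    have hke : p k * (t • y) = t • y := by rw [mul_smul_comm, hky]
    refine ⟨t • y, hke, by rw [smul_mul_assoc, hyl], ?_, hee⟩
    obtain ⟨c', hc'⟩ : ∃ c' : ℂ, (t • y) * star (t • y) = c' • p k := by
      obtain ⟨c', hc'⟩ := corner k ((t • y) * star (t • y))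
      refine ⟨c', ?_⟩
      have : star (t • y) * p k = star (t • y) := by rw [← hps k, ← star_mul, hke]
      rw [← hc', ← mul_assoc, hke, mul_assoc, this]
    have hne : t • y ≠ 0 := fun h => hp0 l (by rw [← hee, h, mul_zero])
    have h1 : c' • (t • y) = (1 : ℂ) • (t • y) := by
      calc c' • (t • y) = (t • y) * star (t • y) * (t • y) := by rw [hc', smul_mul_assoc, hke]
        _ = (1 : ℂ) • (t • y) := by rw [mul_assoc, hee, smul_mul_assoc, hyl, one_smul]
    rw [hc', smul_left_injective ℂ hne h1, one_smul]
  -- The relation of lying in the same simple summand. Transitivity goes through the partial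
  -- isometries, as a product of nonzero corner elements might otherwise vanish.
  let r : Fin n → Fin n → Prop := fun k l => ∃ x, p k * x * p l ≠ 0
  have hr : Equivalence r := by
    refine ⟨fun k => ⟨1, by simpa [hpp] using hp0 k⟩, ?_, ?_⟩
    · rintro k l ⟨x, hx⟩
      refine ⟨star x, fun h => hx ?_⟩
      have := congrArg star h
      simpa [hps, mul_assoc] using this
    · rintro k l m ⟨x, hx⟩ ⟨y, hy⟩
      obtain ⟨e, he1, he2, he3, he4⟩ := iso k l x hx
      refine ⟨e * y, fun h => hy ?_⟩
      calc p l * y * p m = star e * (p k * (e * y) * p m) := by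
            rw [← mul_assoc (p k), he1, ← he4]; simp [mul_assoc]
        _ = 0 := by rw [h, mul_zero]
  let S : Setoid (Fin n) := ⟨r, hr⟩
  -- One representative per summand: all `e k` in a summand share the source projection `p (ρ k)`,
  -- so `star (e k) * x * e l` lies in a one-dimensional corner, or vanishes across summands.
  let ρ : Fin n → Fin n := fun k => (Quotient.mk S k).out
  have hρ : ∀ k, r k (ρ k) := fun k => hr.symm (Quotient.mk_out (s := S) k)
  have hρ' : ∀ k l, r (ρ k) (ρ l) → ρ k = ρ l := fun k l h => by
    have : Quotient.mk S k = Quotient.mk S l :=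
      Quotient.sound (hr.trans (hρ k) (hr.trans h (hr.symm (hρ l))))
    simp only [ρ, this]
  have hex : ∀ k, ∃ e, p k * e = e ∧ e * p (ρ k) = e ∧ e * star e = p k ∧
      star e * e = p (ρ k) := fun k => by
    obtain ⟨x, hx⟩ := hρ k
    exact iso k _ x hx
  choose e he1 he2 he3 he4 using hex
  have he1' : ∀ k, star (e k) * p k = star (e k) := fun k => by
    conv_rhs => rw [← he1 k, star_mul, hps]
  have he2' : ∀ k, p (ρ k) * star (e k) = star (e k) := fun k => by
    conv_rhs => rw [← he2 k, star_mul, hps]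
  refine ⟨n, e, fun k x hx => ⟨?_, ?_⟩, ?_, fun k l x => ?_⟩
  · have h := hpχ (ρ k) ⟨x, hx⟩
    simp only at h
    rw [← he2' k, ← mul_assoc, mul_assoc (e k) x, h,
      mul_smul_comm, smul_mul_assoc, he2, he3]
    exact SMulMemClass.smul_mem _ (hpD k)
  · have h := hpχ k ⟨x, hx⟩
    simp only at h
    rw [← he1 k, ← mul_assoc, mul_assoc _ x, h, he1,
      mul_smul_comm, smul_mul_assoc, mul_assoc, he1, he4]
    exact SMulMemClass.smul_mem _ (hpD _)
  · simp only [he3, hpsum]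
  · have h : star (e k) * x * e l = p (ρ k) * (star (e k) * x * e l) * p (ρ l) := by
      conv_lhs => rw [← he2' k, ← he2 l]
      simp only [mul_assoc]
    by_cases hkl : ρ k = ρ l
    · rw [hkl] at h
      obtain ⟨c, hc⟩ := corner (ρ l) (star (e k) * x * e l)
      rw [h, hc]
      exact SMulMemClass.smul_mem _ (hpD _)
    · have h0 : p (ρ k) * (star (e k) * x * e l) * p (ρ l) = 0 := by
        by_contra hne
        exact hkl (hρ' k l ⟨_, hne⟩)
      rw [h, h0]
      exact zero_mem D

end FiniteDimensional

/-! ### Matrix positivity and Gram factorisations for the expectation. -/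

section Positivity

/-- The decomposition of a self-adjoint element into positive and negative part. -/
lemma exists_pos_sub_neg {C : Type*} [NonUnitalCStarAlgebra C] [PartialOrder C] [StarOrderedRing C]
    {M : C} (hM : IsSelfAdjoint M) :
    ∃ P N T : C, 0 ≤ P ∧ M = P - N ∧ (T * N = 0 → N = 0) ∧
      star N * M * N = - (star (T * N) * (T * N)) := by
  have hN : 0 ≤ M⁻ := CFC.negPart_nonneg M
  have hNs : star (M⁻) = M⁻ := (IsSelfAdjoint.of_nonneg hN).star_eq
  obtain ⟨T, hT⟩ := exists_eq_star_mul_self hN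
  have hdec : M = M⁺ - M⁻ := (CFC.posPart_sub_negPart M hM).symm
  refine ⟨M⁺, M⁻, T, CFC.posPart_nonneg M, hdec, fun h => ?_, ?_⟩
  · rw [← CStarRing.star_mul_self_eq_zero_iff, hNs]
    nth_rewrite 1 [hT]
    rw [mul_assoc, h, mul_zero]
  · have h1 : M * M⁻ = - (M⁻ * M⁻) := by
      nth_rewrite 1 [hdec]
      rw [sub_mul, CFC.posPart_mul_negPart, zero_sub]
    rw [mul_assoc, h1, star_mul, mul_assoc, ← mul_assoc (star T), ← hT, mul_neg]

/-- A self-adjoint matrix over a C⋆-algebra is positive if it is positive on all columns. -/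
lemma cstarMatrix_nonneg {B : Type*} [CStarAlgebra B] [PartialOrder B] [StarOrderedRing B]
    {n : Type*} [Fintype n] {M : CStarMatrix n n B} (hM : IsSelfAdjoint M)
    (hpos : ∀ d : n → B, 0 ≤ ∑ k, ∑ l, star (d k) * M k l * d l) : 0 ≤ M := by
  obtain ⟨P, N, T, hP, hdec, hTN, hneg⟩ := exists_pos_sub_neg hM
  have hTN0 : T * N = 0 := by
    have hcol : ∀ i j, (T * N) i j = 0 := by
      intro i j
      -- Test on the columns of the negative part: each diagonal entry of `star N * M * N` is both
      -- nonnegative and minus a sum of squares.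
      have h1 := hpos fun k => N k j
      have h2 : ∑ k, ∑ l, star (N k j) * M k l * N l j = (star N * M * N) j j := by
        simp only [CStarMatrix.mul_apply, CStarMatrix.star_apply, Finset.sum_mul]
        exact Finset.sum_comm
      rw [h2, hneg, CStarMatrix.neg_apply, Left.nonneg_neg_iff, CStarMatrix.mul_apply] at h1
      simp only [CStarMatrix.star_apply] at h1
      have h3 := (Finset.sum_eq_zero_iff_of_nonneg
        fun i _ => star_mul_self_nonneg ((T * N) i j)).mp
        (le_antisymm h1 (Finset.sum_nonneg fun i _ => star_mul_self_nonneg _)) i (Finset.mem_univ i)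
      exact (CStarRing.star_mul_self_eq_zero_iff _).mp h3
    exact CStarMatrix.ext hcol
  rw [hdec, hTN hTN0, sub_zero]
  exact hP

variable {A : Type*} [CStarAlgebra A] [PartialOrder A] [StarOrderedRing A]
  {D : StarSubalgebra ℂ A} {Φ : A →ₗ[ℂ] D}

lemma exists_mem_eq_star_mul_self (hcl : IsClosed (D : Set A)) {x : A} (hx : x ∈ D) (h0 : 0 ≤ x) :
    ∃ s ∈ D, x = star s * s := by
  have : IsClosed (D : Set A) := hcl
  refine ⟨CFC.sqrt x, ?_, ?_⟩
  · rw [CFC.sqrt_eq_real_sqrt x h0]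
    exact cfcₙ_mem (𝕜' := ℂ) _ hx
  · rw [(IsSelfAdjoint.of_nonneg (CFC.sqrt_nonneg x)).star_eq, CFC.sqrt_mul_sqrt_self x h0]

lemma IsConditionalExpectation.map_star (hΦ : IsConditionalExpectation D Φ) (a : A) :
    (Φ (star a) : A) = star (Φ a : A) := by
  let g : A →ₚ[ℂ] A := PositiveLinearMap.mk₀ (D.subtype.toLinearMap ∘ₗ Φ) hΦ.nonneg
  exact StarHomClass.map_star g a

/-- Complete positivity of conditional expectations, in the form of a Gram factorisation. -/
lemma IsConditionalExpectation.exists_gram (hcl : IsClosed (D : Set A))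
    (hΦ : IsConditionalExpectation D Φ) {n : ℕ} (v : Fin n → A) {z : A} (hz : 0 ≤ z) :
    ∃ N : Fin n → Fin n → A, ∀ k l,
      (Φ (star (v k) * z * v l) : A) = ∑ m, star (N m k) * N m l := by
  have : IsClosed (D : Set A) := hcl
  let _ : CStarAlgebra D := StarSubalgebra.cstarAlgebra D
  let _ : PartialOrder D := CStarAlgebra.spectralOrder D
  have : StarOrderedRing D := CStarAlgebra.spectralOrderedRing D
  let M : CStarMatrix (Fin n) (Fin n) D := CStarMatrix.ofMatrix fun k l => Φ (star (v k) * z * v l)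
  have hMa : ∀ k l, M k l = Φ (star (v k) * z * v l) := fun _ _ => rfl
  have hMs : IsSelfAdjoint M := by
    refine CStarMatrix.ext fun k l => Subtype.ext ?_
    rw [CStarMatrix.star_apply, hMa, hMa]
    change star (Φ _ : A) = _
    rw [← hΦ.map_star]
    simp [(IsSelfAdjoint.of_nonneg hz).star_eq, mul_assoc]
  have hMpos : 0 ≤ M := by
    refine cstarMatrix_nonneg hMs fun d => ?_
    set x : D := ∑ k, ∑ l, star (d k) * M k l * d l with hx
    -- The bimodule property moves the column entries, which lie in `D`, inside `Φ`.
    have hx' : x = Φ (star (∑ k, v k * d k) * z * (∑ l, v l * d l)) := by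
      have : star (∑ k, v k * (d k : A)) * z * (∑ l, v l * (d l : A))
          = ∑ k, ∑ l, ((star (d k) : D) : A) * (star (v k) * z * v l) * (d l : A) := by
        simp only [star_sum, star_mul, Finset.sum_mul, Finset.mul_sum, mul_assoc,
          StarMemClass.coe_star]
        exact Finset.sum_comm
      rw [this, map_sum, hx]
      refine Finset.sum_congr rfl fun k _ => ?_
      rw [map_sum]
      refine Finset.sum_congr rfl fun l _ => ?_
      rw [hΦ.bimodule, hMa]
    have h0 : 0 ≤ (x : A) := by
      rw [hx']
      exact hΦ.nonneg _ (star_left_conjugate_nonneg hz _)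
    obtain ⟨s, hs, hxs⟩ := exists_mem_eq_star_mul_self hcl x.2 h0
    have : x = star (⟨s, hs⟩ : D) * ⟨s, hs⟩ := Subtype.ext hxs
    rw [this]
    exact star_mul_self_nonneg _
  obtain ⟨S, hS⟩ := exists_eq_star_mul_self hMpos
  refine ⟨fun k l => S k l, fun k l => ?_⟩
  rw [← hMa, hS, CStarMatrix.mul_apply]
  simp [CStarMatrix.star_apply]

end Positivity

/-! ### The compression map: positivity, domination and contractivity. -/

section Compression

variable {A : Type*} [CStarAlgebra A] {D : StarSubalgebra ℂ A}

/-- The map `y ↦ ∑ k l, v k * Φ((v k)⋆ y (v l)) * (v l)⋆`. -/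
noncomputable def compression (Φ : A →ₗ[ℂ] D) {n : ℕ} (v : Fin n → A) : A →ₗ[ℂ] A where
  toFun y := ∑ k, ∑ l, v k * (Φ (star (v k) * y * v l) : A) * star (v l)
  map_add' x y := by simp [mul_add, add_mul, Finset.sum_add_distrib]
  map_smul' c x := by simp [Finset.smul_sum]

lemma compression_apply (Φ : A →ₗ[ℂ] D) {n : ℕ} (v : Fin n → A) (y : A) :
    compression Φ v y = ∑ k, ∑ l, v k * (Φ (star (v k) * y * v l) : A) * star (v l) := rfl

lemma sum_gram_eq {n : ℕ} (v : Fin n → A) (N : Fin n → Fin n → A) :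
    ∑ k, ∑ l, v k * (∑ m, star (N m k) * N m l) * star (v l)
      = ∑ m, star (∑ k, N m k * star (v k)) * (∑ l, N m l * star (v l)) := by
  simp only [star_sum, star_mul, star_star, Finset.mul_sum, Finset.sum_mul, mul_assoc]
  rw [Finset.sum_congr rfl fun k _ => Finset.sum_comm, Finset.sum_comm]
  exact Finset.sum_congr rfl fun m _ => Finset.sum_comm

variable [PartialOrder A] [StarOrderedRing A]

/-- Expand `0 ≤ ∑ k l, |s k - s l|²`. -/
lemma star_sum_mul_sum_le {n : ℕ} (s : Fin n → A) :
    star (∑ k, s k) * (∑ k, s k) ≤ (n : ℂ) • ∑ k, star (s k) * s k := by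
  have h : 0 ≤ ∑ k, ∑ l, star (s k - s l) * (s k - s l) :=
    Finset.sum_nonneg fun k _ => Finset.sum_nonneg fun l _ => star_mul_self_nonneg _
  have e : ∑ k, ∑ l, star (s k - s l) * (s k - s l)
      = (2 : ℂ) • ((n : ℂ) • ∑ k, star (s k) * s k - star (∑ k, s k) * (∑ k, s k)) := by
    have h1 : ∑ k, ∑ l, star (s k) * s l = star (∑ k, s k) * (∑ k, s k) := by
      rw [star_sum, Finset.sum_mul_sum]
    have h2 : ∑ k, ∑ l, star (s l) * s k = star (∑ k, s k) * (∑ k, s k) := by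
      rw [Finset.sum_comm, h1]
    have h3 : ∑ k : Fin n, ∑ l : Fin n, star (s k) * s k = (n : ℂ) • ∑ k, star (s k) * s k := by
      simp [Finset.smul_sum, Nat.cast_smul_eq_nsmul]
    have h4 : ∑ k : Fin n, ∑ l : Fin n, star (s l) * s l = (n : ℂ) • ∑ k, star (s k) * s k := by
      rw [Finset.sum_comm, h3]
    simp only [star_sub, sub_mul, mul_sub, Finset.sum_sub_distrib, h1, h2, h3, h4]
    module
  rw [e] at h
  have h5 : 0 ≤ (2⁻¹ : ℂ) • ((2 : ℂ) • ((n : ℂ) • ∑ k, star (s k) * s k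
      - star (∑ k, s k) * (∑ k, s k))) := smul_nonneg (by positivity) h
  rwa [smul_smul, inv_mul_cancel₀ two_ne_zero, one_smul, sub_nonneg] at h5

variable {Φ : A →ₗ[ℂ] D}

lemma compression_nonneg (hcl : IsClosed (D : Set A)) (hΦ : IsConditionalExpectation D Φ) {n : ℕ}
    (v : Fin n → A) {z : A} (hz : 0 ≤ z) : 0 ≤ compression Φ v z := by
  obtain ⟨N, hN⟩ := hΦ.exists_gram hcl v hz
  simp only [compression_apply, hN, sum_gram_eq]
  exact Finset.sum_nonneg fun m _ => star_mul_self_nonneg _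

lemma compression_le_diagonal (hcl : IsClosed (D : Set A)) (hΦ : IsConditionalExpectation D Φ)
    {n : ℕ} (v : Fin n → A) {z : A} (hz : 0 ≤ z) :
    compression Φ v z ≤ (n : ℂ) • ∑ k, v k * (Φ (star (v k) * z * v k) : A) * star (v k) := by
  obtain ⟨N, hN⟩ := hΦ.exists_gram hcl v hz
  simp only [compression_apply, hN, sum_gram_eq]
  refine (Finset.sum_le_sum fun m _ => star_sum_mul_sum_le _).trans_eq ?_
  rw [← Finset.smul_sum, Finset.sum_comm]
  simp only [star_mul, star_star, Finset.mul_sum, Finset.sum_mul, mul_assoc]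

/-- Makes compressions of elements below `a` lie in every hereditary subalgebra containing `Φ a`.
Equivariance turns each diagonal term into `g * Φ z * g` with `g = v k * (v k)⋆ ∈ D`, and
commutativity of `D` gives the bound `‖g‖² Φ z`. -/
lemma exists_compression_le (hD : IsCartanPair D) (hΦ : IsConditionalExpectation D Φ) {n : ℕ}
    {v : Fin n → A} (hv : ∀ k, v k ∈ normalisers D) {z a : A} (hz : 0 ≤ z) (hza : z ≤ a) :
    ∃ C : ℂ, compression Φ v z ≤ C • (Φ a : A) := by
  have h1 : ∀ k, v k * (Φ (star (v k) * z * v k) : A) * star (v k)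
      ≤ (‖v k * star (v k)‖ ^ 2 : ℂ) • (Φ a : A) := by
    intro k
    have hg := mul_star_self_mem (hv k)
    have h0 : 0 ≤ (Φ z : A) := hΦ.nonneg z hz
    have hle : (Φ z : A) ≤ Φ a := by
      have := hΦ.nonneg (a - z) (sub_nonneg.mpr hza)
      rw [map_sub] at this
      exact sub_nonneg.mp this
    obtain ⟨s, hs, hzs⟩ := exists_mem_eq_star_mul_self hD.isClosed (Φ z).2 h0
    obtain ⟨g, hg'⟩ : ∃ g, g = v k * star (v k) := ⟨_, rfl⟩
    have hgs : star g = g := by simp [hg']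
    have e : v k * (star (v k) * (Φ z : A) * v k) * star (v k)
        = v k * star (v k) * Φ z * (v k * star (v k)) := by simp only [mul_assoc]
    rw [expectation_conj hD hΦ (hv k), e]
    rw [← hg'] at hg ⊢
    calc g * Φ z * g = (g * star s) * (s * g) := by rw [hzs]; simp only [mul_assoc]
      _ = star s * (star g * g) * s := by
          rw [hD.masa.comm hg (star_mem hs), hD.masa.comm hs hg, hgs]
          simp only [mul_assoc]
      _ ≤ star s * algebraMap ℝ A (‖g‖ ^ 2) * s :=
          star_left_conjugate_le_conjugate CStarAlgebra.star_mul_le_algebraMap_norm_sq s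
      _ = (‖g‖ ^ 2 : ℂ) • (Φ z : A) := by
          rw [hzs, Algebra.algebraMap_eq_smul_one, mul_smul_comm, mul_one, smul_mul_assoc,
            ← Complex.coe_smul]
          norm_cast
      _ ≤ (‖g‖ ^ 2 : ℂ) • (Φ a : A) := smul_le_smul_of_nonneg_left hle (by positivity)
  refine ⟨n * ∑ k, (‖v k * star (v k)‖ ^ 2 : ℂ), (compression_le_diagonal hD.isClosed hΦ v hz).trans ?_⟩
  rw [mul_smul, Finset.sum_smul]
  exact smul_le_smul_of_nonneg_left (Finset.sum_le_sum fun k _ => h1 k) (by positivity)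

/-- Positivity and `compression Φ v 1 ≤ 1` trap the image of `y` between `-‖y‖` and `‖y‖`. -/
lemma norm_compression_le (hcl : IsClosed (D : Set A)) (hΦ : IsConditionalExpectation D Φ) {n : ℕ}
    {v : Fin n → A} (hv : compression Φ v 1 ≤ 1) {y : A} (hy : IsSelfAdjoint y) :
    ‖compression Φ v y‖ ≤ ‖y‖ := by
  let g : A →ₚ[ℂ] A := PositiveLinearMap.mk₀ (compression Φ v) fun _ => compression_nonneg hcl hΦ v
  have hg : ∀ x, g x = compression Φ v x := fun _ => rfl
  have h1 : ∀ y : A, IsSelfAdjoint y → compression Φ v y ≤ algebraMap ℝ A ‖y‖ := by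
    intro y hy
    calc compression Φ v y = g y := rfl
      _ ≤ g (algebraMap ℝ A ‖y‖) := g.apply_le_of_isSelfAdjoint y hy
      _ = (‖y‖ : ℂ) • compression Φ v 1 := by
          rw [hg, Algebra.algebraMap_eq_smul_one, ← Complex.coe_smul, map_smul]
      _ ≤ (‖y‖ : ℂ) • 1 := smul_le_smul_of_nonneg_left hv (by positivity)
      _ = algebraMap ℝ A ‖y‖ := by rw [Algebra.algebraMap_eq_smul_one, Complex.coe_smul]
  have h2 := h1 (-y) hy.neg
  rw [map_neg, norm_neg] at h2
  have hs : IsSelfAdjoint (compression Φ v y) := IsSelfAdjoint.map' hy g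
  rcases subsingleton_or_nontrivial A with h | h
  · simp [Subsingleton.elim (compression Φ v y) 0]
  rcases CStarAlgebra.norm_or_neg_norm_mem_spectrum hs with h3 | h3
  · exact (le_algebraMap_iff_spectrum_le hs).mp (h1 y hy) _ h3
  · refine (le_algebraMap_iff_spectrum_le hs.neg).mp h2 _ ?_
    rw [← spectrum.neg_eq]
    exact h3

end Compression

/-! ### Resolvents and perturbation below a positive element. -/

section Resolvent

variable {A : Type*} [CStarAlgebra A]

lemma mul_comm_of_resolvent {h g b : A} {δ : ℝ} (hc : h * g = g * h) (h1 : h * g + δ • g = 1)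
    (hb : b * h = h * b) : b * g = g * b := by
  have h2 : (h + δ • 1) * g = 1 := by rw [add_mul, smul_mul_assoc, one_mul, h1]
  have h3 : g * (h + δ • 1) = 1 := by rw [mul_add, ← hc, mul_smul_comm, mul_one, h1]
  have hb' : b * (h + δ • 1) = (h + δ • 1) * b := by simp [mul_add, add_mul, hb]
  calc b * g = g * (h + δ • 1) * b * g := by rw [h3, one_mul]
    _ = g * (b * (h + δ • 1)) * g := by rw [hb']; simp only [mul_assoc]
    _ = g * b * ((h + δ • 1) * g) := by simp only [mul_assoc]
    _ = g * b := by rw [h2, mul_one]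

variable [PartialOrder A] [StarOrderedRing A]

/-- The resolvent `g = (h + δ)⁻¹` of a positive element. -/
lemma exists_resolvent {h : A} (hh : 0 ≤ h) {δ : ℝ} (hδ : 0 < δ) :
    ∃ g : A, star g = g ∧ 0 ≤ h * g ∧ ‖h * g‖ ≤ 1 ∧ ‖δ • g‖ ≤ 1 ∧ h * g = g * h ∧
      h * g + δ • g = 1 := by
  have hsp : ∀ t ∈ spectrum ℝ h, 0 ≤ t := fun t ht => spectrum_nonneg_of_nonneg hh ht
  have hsa : IsSelfAdjoint h := .of_nonneg hh
  have hne : ∀ t ∈ spectrum ℝ h, t + δ ≠ 0 := fun t ht => (add_pos_of_nonneg_of_pos (hsp t ht) hδ).ne'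
  have hc : ContinuousOn (fun t : ℝ => (t + δ)⁻¹) (spectrum ℝ h) :=
    ContinuousOn.inv₀ (by fun_prop) hne
  have hhg : h * cfc (fun t : ℝ => (t + δ)⁻¹) h = cfc (fun t : ℝ => t * (t + δ)⁻¹) h := by
    rw [cfc_mul (fun t : ℝ => t) _ h (by fun_prop) hc, cfc_id' ℝ h]
  have hgh : cfc (fun t : ℝ => (t + δ)⁻¹) h * h = cfc (fun t : ℝ => (t + δ)⁻¹ * t) h := by
    rw [cfc_mul _ (fun t : ℝ => t) h hc (by fun_prop), cfc_id' ℝ h]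
  have hdg : δ • cfc (fun t : ℝ => (t + δ)⁻¹) h = cfc (fun t : ℝ => δ * (t + δ)⁻¹) h := by
    rw [cfc_const_mul _ _ _ hc]
  refine ⟨cfc (fun t : ℝ => (t + δ)⁻¹) h, (cfc_predicate _ h : IsSelfAdjoint _).star_eq, ?_, ?_, ?_,
    ?_, ?_⟩
  · rw [hhg]
    refine cfc_nonneg fun t ht => ?_
    have := hsp t ht
    positivity
  · rw [hhg]
    refine norm_cfc_le zero_le_one fun t ht => ?_
    have := hsp t ht
    rw [Real.norm_of_nonneg (by positivity), ← div_eq_mul_inv, div_le_one (by positivity)]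
    linarith
  · rw [hdg]
    refine norm_cfc_le zero_le_one fun t ht => ?_
    have := hsp t ht
    rw [Real.norm_of_nonneg (by positivity), ← div_eq_mul_inv, div_le_one (by positivity)]
    linarith
  · rw [hhg, hgh]
    simp only [mul_comm]
  · rw [hhg, hdg, ← cfc_add _ _ _ (by fun_prop) (by fun_prop), ← cfc_one ℝ h]
    refine cfc_congr fun t ht => ?_
    have := hne t ht
    simp only [Pi.one_apply]
    field_simp

/-- A positive element below `a + ε` is close to a positive element below `a`. -/
lemma exists_le_near {a c : A} {ε : ℝ} (hε : 0 < ε) (ha : 0 ≤ a) (hc : 0 ≤ c)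
    (hca : c ≤ a + ε • 1) :
    ∃ z, 0 ≤ z ∧ z ≤ a ∧ ‖c - z‖ ≤ 2 * (√ε * √‖c‖) := by
  obtain ⟨g, hgs, hk0, hk1, hg1, hag, h1⟩ := exists_resolvent ha hε
  set k := a * g with hk
  have hks : star k = k := (IsSelfAdjoint.of_nonneg hk0).star_eq
  have h1k : 1 - k = ε • g := by rw [← h1]; abel
  have hg2 : (a + ε • 1) * g = 1 := by rw [add_mul, smul_mul_assoc, one_mul, h1]
  -- With `k = a (a + ε)⁻¹`, `k c k ≤ k (a + ε) k = a - ε k ≤ a`, while `(1 - k) c (1 - k) ≤ ε² (a +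
  -- ε)⁻¹` has norm at most `ε`.
  refine ⟨k * c * k, ?_, ?_, ?_⟩
  · simpa [hks] using star_left_conjugate_nonneg hc k
  · have h2 : k * c * k ≤ k * (a + ε • 1) * k := by
      simpa [hks] using star_left_conjugate_le_conjugate hca k
    have h3 : k * (a + ε • 1) * k = a - ε • k := by
      calc k * (a + ε • 1) * k = k * ((a + ε • 1) * g) * a := by
            nth_rewrite 2 [hag]; simp only [mul_assoc]
        _ = (1 - (1 - k)) * a := by rw [hg2, mul_one, sub_sub_cancel]
        _ = a - ε • k := by rw [h1k, sub_mul, one_mul, smul_mul_assoc, ← hag]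
    refine h2.trans ?_
    rw [h3]
    exact sub_le_self _ (smul_nonneg hε.le hk0)
  · obtain ⟨s, hs⟩ := exists_eq_star_mul_self hc
    have hsn : ‖s‖ = √‖c‖ := by
      rw [hs, CStarRing.norm_star_mul_self, Real.sqrt_mul_self (norm_nonneg _)]
    have hd : ‖s * (1 - k)‖ ≤ √ε := by
      apply Real.le_sqrt_of_sq_le
      rw [sq, ← CStarRing.norm_star_mul_self]
      have e1 : star (s * (1 - k)) * (s * (1 - k)) = star (1 - k) * c * (1 - k) := by
        rw [hs, star_mul]; simp only [mul_assoc]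
      have e2 : star (1 - k) * (a + ε • 1) * (1 - k) = ε • (ε • g) := by
        rw [star_sub, star_one, hks, h1k, mul_smul_comm, mul_assoc, hg2, mul_one]
      rw [e1]
      refine (CStarAlgebra.norm_le_norm_of_nonneg_of_le (star_left_conjugate_nonneg hc _)
        (star_left_conjugate_le_conjugate hca (1 - k))).trans ?_
      rw [e2, norm_smul, Real.norm_of_nonneg hε.le]
      exact mul_le_of_le_one_right hε.le hg1
    have hd' : ‖(1 - k) * star s‖ ≤ √ε := by
      rw [← norm_star, star_mul, star_star, star_sub, star_one, hks]
      exact hd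
    have e : c - k * c * k = (1 - k) * star s * s + k * star s * (s * (1 - k)) := by
      rw [hs]; noncomm_ring
    rw [e]
    calc ‖(1 - k) * star s * s + k * star s * (s * (1 - k))‖
        ≤ ‖(1 - k) * star s‖ * ‖s‖ + ‖k‖ * ‖star s‖ * ‖s * (1 - k)‖ := by
          refine (norm_add_le _ _).trans (add_le_add (norm_mul_le _ _) ((norm_mul_le _ _).trans ?_))
          gcongr
          exact norm_mul_le _ _
      _ ≤ √ε * √‖c‖ + 1 * √‖c‖ * √ε := by
          rw [norm_star, hsn]
          gcongr
      _ = 2 * (√ε * √‖c‖) := by ring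

end Resolvent

/-! ### Compressions that almost fix the image of an order zero map. -/

section OrderZeroCompression

variable {F A : Type*} [CStarAlgebra F] [PartialOrder F] [StarOrderedRing F]
  [CStarAlgebra A] [PartialOrder A] [StarOrderedRing A]
  {D : StarSubalgebra ℂ A} {DF : StarSubalgebra ℂ F}

/-- A positive map that preserves normalisers maps the diagonal into the diagonal. -/
lemma map_mem_of_map_normalisers (hcl : IsClosed (D : Set A)) {φ : F →CP A}
    (hφ : ∀ v ∈ normalisers DF, φ v ∈ normalisers D) {x : F} (hx : x ∈ DF) : φ x ∈ D := by
  have hpos : ∀ y ∈ DF, 0 ≤ y → φ y ∈ D := fun y hy h0 =>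
    mem_of_nonneg_of_mem_normalisers hcl (map_nonneg φ h0) (hφ y (mem_normalisers_of_mem hy))
  have hsa : ∀ y ∈ DF, IsSelfAdjoint y → φ y ∈ D := by
    intro y hy hys
    have h1 : y = (y + (‖y‖ : ℂ) • 1) - (‖y‖ : ℂ) • 1 := by abel
    have h2 : 0 ≤ y + (‖y‖ : ℂ) • 1 := by
      have := IsSelfAdjoint.neg_algebraMap_norm_le_self hys
      rw [Algebra.algebraMap_eq_smul_one, neg_le_iff_add_nonneg, ← Complex.coe_smul] at this
      exact this
    rw [h1, map_sub, map_smul]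
    exact sub_mem (hpos _ (add_mem hy (SMulMemClass.smul_mem _ (one_mem DF))) h2)
      (SMulMemClass.smul_mem _ (hpos 1 (one_mem DF) zero_le_one))
  have h1 : (realPart x : F) ∈ DF := by
    rw [realPart_apply_coe, ← Complex.coe_smul]
    exact SMulMemClass.smul_mem _ (add_mem hx (star_mem hx))
  have h2 : (imaginaryPart x : F) ∈ DF := by
    rw [imaginaryPart_apply_coe, ← Complex.coe_smul]
    exact SMulMemClass.smul_mem _ (SMulMemClass.smul_mem _ (sub_mem hx (star_mem hx)))
  rw [← realPart_add_I_smul_imaginaryPart x, map_add, map_smul]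
  exact add_mem (hsa _ h1 (realPart x).2) (SMulMemClass.smul_mem _ (hsa _ h2 (imaginaryPart x).2))

variable [FiniteDimensional ℂ F]

/-- The image of an order zero map is almost fixed by a contractive compression along
normalisers. -/
lemma exists_compression_near (hcl : IsClosed (D : Set A)) (hD : IsMasa D) (hDF : IsMasa DF)
    {Φ : A →ₗ[ℂ] D} (hΦ : IsConditionalExpectation D Φ) {φ : F →CP A}
    (hoz : IsOrderZero φ.toLinearMap) (hφ : ∀ v ∈ normalisers DF, φ v ∈ normalisers D)
    (x : F) {ε : ℝ} (hε : 0 < ε) :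
    ∃ (n : ℕ) (v : Fin n → A), (∀ k, v k ∈ normalisers D) ∧ compression Φ v 1 ≤ 1 ∧
      ‖compression Φ v (φ x) - φ x‖ ≤ ε := by
  obtain ⟨n, e, heN, hesum, heD⟩ := exists_normaliser_frame hDF
  have hmul := order_zero_mul hoz
  have hcomm := order_zero_commute hoz
  have hh0 : 0 ≤ φ 1 := map_nonneg φ zero_le_one
  have hφD : ∀ y ∈ DF, φ y ∈ D := fun y hy => map_mem_of_map_normalisers hcl hφ hy
  have hhD : φ 1 ∈ D := hφD 1 (one_mem DF)
  set K : ℝ := ‖φ (x * star x)‖ with hK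
  have hK0 : 0 ≤ K := norm_nonneg _
  -- Chosen so that `√(δ K) ≤ ε / 4`, which bounds `(1 - q) φ(x)` for `q = φ 1 * g`.
  set δ : ℝ := ε ^ 2 / (16 * (K + 1)) with hδ'
  have hδ : 0 < δ := by positivity
  have hδK : δ * K ≤ (ε / 4) ^ 2 := by
    rw [hδ', div_mul_eq_mul_div, div_le_iff₀ (by positivity)]
    nlinarith [sq_nonneg ε]
  obtain ⟨g, hgs, hq0, hq1, hdg, hhg, h1⟩ := exists_resolvent hh0 hδ
  have hgφ : ∀ y, φ y * g = g * φ y := fun y => mul_comm_of_resolvent hhg h1 (hcomm y)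
  have hgD : g ∈ D := hD.mem_of_commute fun y hy =>
    mul_comm_of_resolvent hhg h1 (hD.comm hy hhD)
  have hstar : ∀ k, star (φ (e k) * g) = g * φ (star (e k)) := fun k => by
    rw [star_mul, hgs, map_star]
  -- An opaque name for `φ 1` keeps `hmul` from rewriting its own right-hand side.
  obtain ⟨h, hh⟩ : ∃ h, h = φ 1 := ⟨_, rfl⟩
  simp only [← hh] at hmul hcomm hh0 hhD hq0 hq1 hhg h1
  have hhg' : ∀ z, h * (g * z) = g * (h * z) := fun z => by
    rw [← mul_assoc, hhg, mul_assoc]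
  have hgφ' : ∀ y z, φ y * (g * z) = g * (φ y * z) := fun y z => by
    rw [← mul_assoc, hgφ, mul_assoc]
  have hhφ' : ∀ y z, φ y * (h * z) = h * (φ y * z) := fun y z => by
    rw [← mul_assoc, hcomm, mul_assoc]
  -- Under this hypothesis each `(v k)⋆ y (v l)` lies in `D` and is fixed by `Φ`; `∑ k, e k * star
  -- (e k) = 1` then reassembles `y'`.
  have hcomp : ∀ (y : A) (y' : F) (w : A), w ∈ D → (∀ u, φ u * w = w * φ u) →
      (∀ k l, star (φ (e k) * g) * y * (φ (e l) * g) = w * φ (star (e k) * y' * e l)) →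
      compression Φ (fun k => φ (e k) * g) y = g * w * (g * h * h) * φ y' := by
    intro y y' w hw hwφ hy
    have hsum : y' = ∑ k, ∑ l, e k * (star (e k) * y' * e l) * star (e l) := by
      have : ∀ k l, e k * (star (e k) * y' * e l) * star (e l)
          = e k * star (e k) * y' * (e l * star (e l)) := fun k l => by simp only [mul_assoc]
      simp only [this, ← Finset.mul_sum, ← Finset.sum_mul, hesum, one_mul, mul_one]
    have hwφ' : ∀ u z, φ u * (w * z) = w * (φ u * z) := fun u z => by
      rw [← mul_assoc, hwφ, mul_assoc]
    conv_rhs => rw [hsum]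
    simp only [compression_apply, map_sum, Finset.mul_sum]
    refine Finset.sum_congr rfl fun k _ => Finset.sum_congr rfl fun l _ => ?_
    rw [hy, hΦ.map_mem (mul_mem hw (hφD _ (heD k l y'))), hstar]
    generalize star (e k) * y' * e l = m
    simp only [mul_assoc, hgφ', hwφ', hmul, hhg']
  have hΘ1 : compression Φ (fun k => φ (e k) * g) 1 = (h * g) ^ 4 := by
    rw [hcomp 1 1 (g * g * h) (mul_mem (mul_mem hgD hgD) hhD) (fun u => ?_) (fun k l => ?_), ← hh]
    · simp only [pow_succ, pow_zero, one_mul, mul_assoc, hhg', hhg]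
    · simp only [mul_assoc, hgφ', hcomm]
    · rw [hstar, mul_one, mul_one]
      simp only [mul_assoc, hmul, hgφ, hgφ']
  have hΘx : compression Φ (fun k => φ (e k) * g) (φ x) = (h * g) ^ 4 * φ x := by
    rw [hcomp (φ x) x (g * g * h * h)
      (mul_mem (mul_mem (mul_mem hgD hgD) hhD) hhD) (fun u => ?_) (fun k l => ?_)]
    · simp only [pow_succ, pow_zero, one_mul, mul_assoc, hhg', hhg]
    · simp only [mul_assoc, hgφ', hcomm, hhφ']
    · rw [hstar]
      simp only [mul_assoc, hmul, hgφ, hgφ', hhg']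
  refine ⟨n, fun k => φ (e k) * g, fun k => mul_mem_normalisers (hφ _ (heN k))
    (mem_normalisers_of_mem hgD), ?_, ?_⟩
  · have h0 : 0 ≤ (h * g) ^ 4 := CStarAlgebra.pow_nonneg hq0 4
    rw [hΘ1, ← CStarAlgebra.norm_le_one_iff_of_nonneg _ h0]
    exact (norm_pow_le' _ (by norm_num)).trans (pow_le_one₀ (norm_nonneg _) hq1)
  · rw [hΘx]
    have hy : ‖δ • g * φ x‖ ≤ ε / 4 := by
      refine abs_le_of_sq_le_sq' ?_ (by positivity) |>.2
      rw [sq, ← CStarRing.norm_self_mul_star]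
      have : δ • g * φ x * star (δ • g * φ x) = δ • ((h * g) * (δ • g) * φ (x * star x)) := by
        rw [star_mul, star_smul, hgs, ← map_star]
        simp only [smul_mul_assoc, mul_smul_comm, mul_assoc, hmul, hgφ, hgφ', hhg', star_trivial]
      rw [this, norm_smul, Real.norm_of_nonneg hδ.le]
      refine le_trans ?_ hδK
      gcongr
      refine (norm_mul_le _ _).trans (mul_le_of_le_one_left (norm_nonneg _) ?_)
      exact (norm_mul_le _ _).trans (mul_le_one₀ hq1 (norm_nonneg _) hdg)
    set y := δ • g * φ x with hy'
    set q := h * g with hq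
    have hyq : φ x = q * φ x + y := by rw [hy', ← add_mul, h1, one_mul]
    -- Factor `1 - q⁴ = (1 + q + q² + q³)(1 - q)`: four terms of norm at most `ε / 4`.
    have e : q ^ 4 * φ x - φ x = -(y + q * y + q * (q * y) + q * (q * (q * y))) := by
      rw [show y = φ x - q * φ x from eq_sub_of_add_eq' hyq.symm]
      noncomm_ring
    have hqn : ∀ z, ‖q * z‖ ≤ ‖z‖ := fun z =>
      (norm_mul_le _ _).trans (mul_le_of_le_one_left (norm_nonneg _) hq1)
    rw [e, norm_neg]
    have n1 := hqn y
    have n2 := hqn (q * y)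
    have n3 := hqn (q * (q * y))
    have t1 := norm_add_le (y + q * y + q * (q * y)) (q * (q * (q * y)))
    have t2 := norm_add_le (y + q * y) (q * (q * y))
    have t3 := norm_add_le y (q * y)
    linarith

end OrderZeroCompression

/-! ### Approximating `a` from a hereditary subalgebra. -/

section Hereditary

variable {A : Type*} [CStarAlgebra A] [PartialOrder A] [StarOrderedRing A]

/-- The restriction of a completely positive map to a summand of a direct sum. -/
noncomputable def cpSingle {ι : Type*} [Fintype ι] [DecidableEq ι] {F : ι → Type*}
    [∀ i, CStarAlgebra (F i)] [∀ i, PartialOrder (F i)] [∀ i, StarOrderedRing (F i)]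
    (φ : ((i : ι) → F i) →CP A) (i : ι) : F i →CP A where
  toLinearMap := φ.toLinearMap ∘ₗ LinearMap.single ℂ F i
  map_cstarMatrix_nonneg' k M hM := by
    obtain ⟨S, rfl⟩ := exists_eq_star_mul_self hM
    -- The inclusion of a summand is multiplicative and ⋆-preserving, so it carries `star S * S` to
    -- `star T * T`.
    let T : CStarMatrix (Fin k) (Fin k) ((i : ι) → F i) := S.map (Pi.single i)
    have h : 0 ≤ (star T * T).map φ := φ.map_cstarMatrix_nonneg _ (star_mul_self_nonneg T)
    convert h using 1
    refine CStarMatrix.ext fun a b => ?_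
    have hmul : ∀ y z : F i, LinearMap.single ℂ F i (star y * z)
        = star (Pi.single i y) * Pi.single i z := fun y z => by
      rw [LinearMap.coe_single, Pi.single_mul, Pi.single_star]
    refine congrArg φ ?_
    rw [CStarMatrix.mul_apply, CStarMatrix.mul_apply, map_sum]
    exact Finset.sum_congr rfl fun m _ => hmul (S m a) (S m b)

lemma cpSingle_apply {ι : Type*} [Fintype ι] [DecidableEq ι] {F : ι → Type*}
    [∀ i, CStarAlgebra (F i)] [∀ i, PartialOrder (F i)] [∀ i, StarOrderedRing (F i)]
    (φ : ((i : ι) → F i) →CP A) (i : ι) (x : F i) : cpSingle φ i x = φ (Pi.single i x) := rfl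

variable {D : StarSubalgebra ℂ A} {Φ : A →ₗ[ℂ] D}

/-- Each of the `d + 1` summands costs the distance from `c i` to some `z ≤ a`, not increased by the
compression, plus `ε` for the compression almost fixing `c i`. The last `ε` is the distance from `φ
(ψ a)` to `a`. -/
lemma exists_mem_near_of_diagDimLE (hD : IsCartanPair D) (hΦ : IsConditionalExpectation D Φ)
    {d : ℕ} (hd : DiagDimLE D d) {a : A} (ha : 0 ≤ a) {H : NonUnitalStarSubalgebra ℂ A}
    (hH : IsHereditarySubalgebra H) (haH : (Φ a : A) ∈ H) {ε : ℝ} (hε : 0 < ε) :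
    ∃ y ∈ H, ‖y - a‖ ≤ (d + 1) * (2 * (√ε * √(‖a‖ + ε)) + ε) + ε := by
  obtain ⟨F, ψ, φ, -, happ, -, -, hoz, hnorm⟩ := hd {a} ε hε
  have happ : ‖φ (ψ a) - a‖ < ε := happ a (Finset.mem_singleton_self a)
  let c : Fin (d + 1) → A := fun i => cpSingle φ i (ψ a i)
  have hc0 : ∀ i, 0 ≤ c i := fun i => map_nonneg (cpSingle φ i) ((map_nonneg ψ ha : 0 ≤ ψ a) i)
  have hcsum : ∑ i, c i = φ (ψ a) := by
    simp only [c, cpSingle_apply, ← map_sum, Finset.univ_sum_single]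
  have hcle : ∀ i, c i ≤ φ (ψ a) := fun i => by
    rw [← hcsum]
    exact Finset.single_le_sum (fun j _ => hc0 j) (Finset.mem_univ i)
  have hφψ0 : 0 ≤ φ (ψ a) := map_nonneg φ (map_nonneg ψ ha)
  have hca : ∀ i, c i ≤ a + ε • 1 := by
    intro i
    refine (hcle i).trans ?_
    have h1 : IsSelfAdjoint (φ (ψ a) - a) := (IsSelfAdjoint.of_nonneg hφψ0).sub (.of_nonneg ha)
    have h2 := h1.le_algebraMap_norm_self
    rw [Algebra.algebraMap_eq_smul_one, sub_le_iff_le_add'] at h2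
    refine h2.trans (add_le_add_right ?_ a)
    exact smul_le_smul_of_nonneg_right happ.le zero_le_one
  have hcn : ∀ i, ‖c i‖ ≤ ‖a‖ + ε := by
    intro i
    refine (CStarAlgebra.norm_le_norm_of_nonneg_of_le (hc0 i) (hcle i)).trans ?_
    have := norm_add_le (φ (ψ a) - a) a
    rw [sub_add_cancel] at this
    linarith
  have key : ∀ i, ∃ y ∈ H, ‖y - c i‖ ≤ 2 * (√ε * √(‖a‖ + ε)) + ε := by
    intro i
    obtain ⟨z, hz0, hza, hzc⟩ := exists_le_near hε ha (hc0 i) (hca i)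
    obtain ⟨n, v, hv, hv1, hvx⟩ := exists_compression_near hD.isClosed hD.masa (F i).isMasa hΦ
      (φ := cpSingle φ i) (hoz i) (hnorm i) (ψ a i) hε
    obtain ⟨C, hC⟩ := exists_compression_le hD hΦ hv hz0 hza
    refine ⟨compression Φ v z, hH.hereditary _ _ (SMulMemClass.smul_mem C haH)
      (compression_nonneg hD.isClosed hΦ v hz0) hC, ?_⟩
    have hsa : IsSelfAdjoint (c i - z) := (IsSelfAdjoint.of_nonneg (hc0 i)).sub (.of_nonneg hz0)
    have h1 := norm_compression_le hD.isClosed hΦ hv1 hsa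
    have e : compression Φ v z - c i
        = (compression Φ v (c i) - c i) - compression Φ v (c i - z) := by
      rw [map_sub]; abel
    rw [e]
    have h2 : √‖c i‖ ≤ √(‖a‖ + ε) := Real.sqrt_le_sqrt (hcn i)
    have h3 : 2 * (√ε * √‖c i‖) ≤ 2 * (√ε * √(‖a‖ + ε)) := by gcongr
    have h4 := norm_sub_le (compression Φ v (c i) - c i) (compression Φ v (c i - z))
    have h5 : ‖compression Φ v (c i) - c i‖ ≤ ε := hvx
    linarith
  choose y hyH hy using key
  refine ⟨∑ i, y i, sum_mem fun i _ => hyH i, ?_⟩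
  have e : ∑ i, y i - a = ∑ i, (y i - c i) + (φ (ψ a) - a) := by
    rw [Finset.sum_sub_distrib, hcsum]; abel
  rw [e]
  refine (norm_add_le _ _).trans (add_le_add ?_ happ.le)
  refine (norm_sum_le_of_le _ fun i _ => hy i).trans_eq ?_
  simp only [Finset.sum_const, Finset.card_univ, Fintype.card_fin, nsmul_eq_mul]
  push_cast
  rfl

theorem isHereditaryMap_of_diagDimLE (hD : IsCartanPair D) (hΦ : IsConditionalExpectation D Φ)
    {d : ℕ} (hd : DiagDimLE D d) : IsHereditaryMap D Φ := by
  intro a ha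
  simp only [her, NonUnitalStarAlgebra.mem_sInf, Set.mem_ofPred_eq]
  rintro H ⟨hH, haH⟩
  have hmem : a ∈ closure (H : Set A) := by
    rw [Metric.mem_closure_iff]
    intro η hη
    have hlim : Filter.Tendsto
        (fun ε : ℝ => (d + 1) * (2 * (√ε * √(‖a‖ + ε)) + ε) + ε) (nhdsWithin 0 (Set.Ioi 0))
        (nhds 0) := by
      have hcont : Continuous fun ε : ℝ => ((d : ℝ) + 1) * (2 * (√ε * √(‖a‖ + ε)) + ε) + ε := by
        fun_prop
      have := hcont.tendsto 0
      simp only [Real.sqrt_zero, zero_mul, mul_zero, add_zero] at this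
      exact this.mono_left nhdsWithin_le_nhds
    obtain ⟨ε, hlt, hε⟩ := ((hlim.eventually (gt_mem_nhds hη)).and self_mem_nhdsWithin).exists
    obtain ⟨y, hy, hya⟩ := exists_mem_near_of_diagDimLE hD hΦ hd ha hH haH hε
    exact ⟨y, hy, by rw [dist_comm, dist_eq_norm]; exact hya.trans_lt hlt⟩
  rwa [hH.isClosed.closure_eq] at hmem

end Hereditary
end DiagonalPair

theorem propositionD {A : Type*} [CStarAlgebra A] [PartialOrder A] [StarOrderedRing A]
    (D : StarSubalgebra ℂ A) (hD : DiagonalPair.IsDiagonalPair D)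
    (Φ : A →ₗ[ℂ] D) (hΦ : DiagonalPair.IsAssociatedExpectation D Φ)
    (hdim : DiagonalPair.diagDim D < ⊤) :
    DiagonalPair.IsHereditaryMap D Φ := by
  obtain ⟨d, hd⟩ : ∃ d, DiagonalPair.DiagDimLE D d := by
    by_contra! h
    simp [DiagonalPair.diagDim, h] at hdim
  exact DiagonalPair.isHereditaryMap_of_diagDimLE hD.toIsCartanPair
    hΦ.toIsConditionalExpectation hd
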